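/- A (bivariate) copula is a function $C\colon[0,1]^2\to[0,1]$ with $C(u,0)=0=C(0,u)$ and $C(u,1)=u=C(1,u)$ for all $u$, and $C(u,v)+C(u',v')-C(u,v')-C(u',v)\ge 0$ for all $u\le u'$, $v\le v'$. Let $\mathcal C$ be the set of all copulas, and for $C\in\mathcal C$ let \[ \xi(C)=6\int_0^1\!\!\int_0^1\bigl(\partial_1 C(t,v)\bigr)^2\,dt\,dv-2,\qquad \rho(C)=12\int_{[0,1]^2}C(u,v)\,d\lambda^2(u,v)-3 \] be Chatterjee's xi and Spearman's rho (for each $v$, the derivative $\partial_1C(t,v)$ exists for almost every $t$). Put \[ b_x=\begin{cases}\dfrac{\sqrt{6x}}{2\cos\left(\frac13\arccos\left(-\frac{3\sqrt{6x}}5\right)\right)},&0<x\le\frac3{10},\\[2ex]\dfrac{5+\sqrt{5(6x-1)}}{10(1-x)},&\frac3{10}<x<1,\end{cases} \qquad M_x=\begin{cases}0,&x=0,\\ b_x-\frac{3b_x^2}{10},&0<x\le\frac3{10},\\ 1-\frac1{2b_x^2}+\frac1{5b_x^3},&\frac3{10}<x<1,\\ 1,&x=1.\end{cases} \] For $b>0$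 and $v\in[0,1]$ let \[ s_v=\begin{cases}\sqrt{2v/b},&(b\ge1\text{ and }v\le\frac1{2b})\text{ or }(b\le1\text{ and }v\le\frac b2),\\ v+\frac1{2b},&\frac1{2b}<v\le1-\frac1{2b},\\ \frac vb+\frac12,&\frac b2<v\le1-\frac b2,\\ 1+\frac1b-\sqrt{2(1-v)/b},&(b\ge1\text{ and }1-\frac1{2b}<v)\text{ or }(b\le1\text{ and }1-\frac b2<v),\end{cases} \] and, for $u,v\in[0,1]$, \[ C_b(u,v)=\int_0^u\min\{\max\{b(s_v-t),0\},1\}\,dt , \] and for $b<0$ let $C_b(u,v)=v-C_{-b}(1-u,v)$. **Theorem.** The set of attainable pairs is \[ \mathcal R:=\{(\xi(C),\rho(C)):C\in\mathcal C\}=\{(x,y)\in\mathbb R^2: x\in[0,1],\ |y|\le M_x\}. \] The set $\mathcal R$ is convex. Every $C_b$ with $b\in\mathbb R\setminus\{0\}$ is a copula, and the family describes the boundary of $\mathcal R$: one has $\partial\mathcal R\cap\{(x,y):0<x<1\}=\{(\xi(C_b),\rho(C_b)):b\in\mathbb R\setminus\{0\}\}$. More precisely, for every $x\in(0,1)$,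 the function $C_{b_x}$ is a copula with $\xi=x$ and $\rho=M_x$ and is the only such copula, and $C_{-b_x}$ is a copula with $\xi=x$ and $\rho=-M_x$ and is the only such copula. -/

import Mathlib

open Set MeasureTheory

noncomputable section

/-- A bivariate copula: a function on the unit square with values in `[0,1]` that is grounded,
has uniform marginals and is two-increasing. It is represented by a function on `ℝ × ℝ`
of which only the values on `[0,1] × [0,1]` matter. -/
structure IsCopula (C : ℝ → ℝ → ℝ) : Prop where
  mapsTo : ∀ u ∈ Icc (0 : ℝ) 1, ∀ v ∈ Icc (0 : ℝ) 1, C u v ∈ Icc (0 : ℝ) 1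
  grounded_left : ∀ v ∈ Icc (0 : ℝ) 1, C 0 v = 0
  grounded_right : ∀ u ∈ Icc (0 : ℝ) 1, C u 0 = 0
  marginal_left : ∀ v ∈ Icc (0 : ℝ) 1, C 1 v = v
  marginal_right : ∀ u ∈ Icc (0 : ℝ) 1, C u 1 = u
  two_increasing : ∀ u ∈ Icc (0 : ℝ) 1, ∀ u' ∈ Icc (0 : ℝ) 1,
    ∀ v ∈ Icc (0 : ℝ) 1, ∀ v' ∈ Icc (0 : ℝ) 1, u ≤ u' → v ≤ v' →
      0 ≤ C u v + C u' v' - C u v' - C u' v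

/-- Spearman's rho of a copula, `12 ∫ C dλ² - 3` over the unit square. -/
def spearmanRho (C : ℝ → ℝ → ℝ) : ℝ :=
  12 * (∫ p : ℝ × ℝ in Icc (0 : ℝ) 1 ×ˢ Icc (0 : ℝ) 1, C p.1 p.2) - 3

/-- Chatterjee's xi of a copula, `6 ∫₀¹ ∫₀¹ (∂₁ C(t,v))² dt dv - 2`. For a copula the partial
derivative exists for almost every `t` in `[0,1]` and is bounded there by `0` and `1`. -/
def chatterjeeXi (C : ℝ → ℝ → ℝ) : ℝ :=
  6 * (∫ v in (0 : ℝ)..1, ∫ t in (0 : ℝ)..1, (deriv (fun s => C s v) t) ^ 2) - 2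

/-- The set of all attainable pairs `(ξ(C), ρ(C))`. -/
def xiRhoRegion : Set (ℝ × ℝ) :=
  {p | ∃ C : ℝ → ℝ → ℝ, IsCopula C ∧ p = (chatterjeeXi C, spearmanRho C)}

/-- The parameter `b_x`, for `0 < x < 1`. -/
def bParam (x : ℝ) : ℝ :=
  if x ≤ 3 / 10 then
    √(6 * x) / (2 * Real.cos (1 / 3 * Real.arccos (-(3 * √(6 * x) / 5))))
  else
    (5 + √(5 * (6 * x - 1))) / (10 * (1 - x))

/-- The bound `M_x`, for `0 ≤ x ≤ 1`. -/
def maxRho (x : ℝ) : ℝ :=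
  if x = 0 then 0
  else if x ≤ 3 / 10 then bParam x - 3 * bParam x ^ 2 / 10
  else if x < 1 then 1 - 1 / (2 * bParam x ^ 2) + 1 / (5 * bParam x ^ 3)
  else 1

/-- The horizontal band-maximum `s_v`, for `b > 0` and `0 ≤ v ≤ 1`. The last branch is the case
`1 ≤ b`, `1 - 1 / (2 b) < v` or `b ≤ 1`, `1 - b / 2 < v`. -/
def bandMax (b v : ℝ) : ℝ :=
  if (1 ≤ b ∧ v ≤ 1 / (2 * b)) ∨ (b ≤ 1 ∧ v ≤ b / 2) then √(2 * v / b)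
  else if 1 / (2 * b) < v ∧ v ≤ 1 - 1 / (2 * b) then v + 1 / (2 * b)
  else if b / 2 < v ∧ v ≤ 1 - b / 2 then v / b + 1 / 2
  else 1 + 1 / b - √(2 * (1 - v) / b)

/-- The function `C_b` for `b > 0`: the integral over `[0,u]` of the clamped linear function
`h_v(t) = clamp (b (s_v - t), 0, 1)`. With `a_v = s_v - 1 / b` and `a = max a_v 0`, this is
`u` for `u ≤ a_v`, is `a + b (s_v (u - a) + (a² - u²) / 2)` for `a < u ≤ s_v`, and is `v`
for `s_v < u ≤ 1`. -/
def bandCopulaPos (b u v : ℝ) : ℝ :=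
  ∫ t in (0 : ℝ)..u, min (max (b * (bandMax b v - t)) 0) 1

/-- The family `C_b`, for `b ≠ 0`; for `b < 0` it is `v - C_{-b}(1 - u, v)`. -/
def bandCopula (b u v : ℝ) : ℝ :=
  if 0 < b then bandCopulaPos b u v else v - bandCopulaPos (-b) (1 - u) v

end

/-!
For fixed `v` the section `t ↦ ∂₁ C(t, v)` of a copula takes values in `[0, 1]` and has integral
`v`, and `∫ C(u, v) du = ∫ (1 - t) ∂₁ C(t, v) dt`. So both `ξ` and `ρ` are integrals over `v` of
functionals of the sections, the first quadratic and the second linear, and maximizing `b ρ - ξ`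
amounts to finding, for each `v`, the point closest to `-b t` among the functions with values in
`[0, 1]` and integral `v`. That point is the clamped ramp `clamp (b (s - t), 0, 1)` whose threshold
`s` is fixed by the mean: this is the section of `C_b`, the monotonicity of `s_v` in `v` making
`C_b` a copula. The variational inequality of the projection has a quadratic gap, so `C_b` is the
only maximizer.

Hence the line of slope `1 / b` through `(ξ(C_b), ρ(C_b))` lies above the region. Integrating the
explicit ramps gives `ξ(C_b)` and `ρ(C_b)`, and `b_x` solves `ξ(C_b) = x`, a cubic equation for
`b ≤ 1` and a quadratic one in `1 / b` for `b ≥ 1`; so `M_x` is the infimum of these lines, which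
makes it concave. Reversing the first coordinate changes the sign of `ρ` and keeps `ξ`. Reversing
it only on `[θ, 1]` also keeps `ξ` and varies continuously with `θ`, so the values of `ρ` between
`-M_x` and `M_x` are attained.
-/

noncomputable section

open scoped unitInterval Topology

namespace IsCopula

variable {C D : ℝ → ℝ → ℝ} {u u' v : ℝ}

lemma of_two_increasing (hl : ∀ v ∈ I, C 0 v = 0) (hr : ∀ u ∈ I, C u 0 = 0)
    (ml : ∀ v ∈ I, C 1 v = v) (mr : ∀ u ∈ I, C u 1 = u)
    (h2 : ∀ u ∈ I, ∀ u' ∈ I, ∀ v ∈ I, ∀ v' ∈ I, u ≤ u' → v ≤ v' →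
      0 ≤ C u v + C u' v' - C u v' - C u' v) : IsCopula C where
  mapsTo u hu v hv := by
    have h_nonneg := h2 0 unitInterval.zero_mem u hu 0 unitInterval.zero_mem v hv hu.1 hv.1
    have h_le := h2 0 unitInterval.zero_mem u hu v hv 1 unitInterval.one_mem hu.1 hv.2
    rw [hl v hv] at h_nonneg h_le
    rw [hl 0 unitInterval.zero_mem, hr u hu] at h_nonneg
    rw [hl 1 unitInterval.one_mem, mr u hu] at h_le
    exact ⟨by linarith, by linarith [hu.2]⟩
  grounded_left := hl
  grounded_right := hr
  marginal_left := ml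
  marginal_right := mr
  two_increasing := h2

lemma swap (hC : IsCopula C) : IsCopula fun u v => C v u :=
  of_two_increasing hC.grounded_right hC.grounded_left hC.marginal_right hC.marginal_left
    fun u hu u' hu' v hv v' hv' h h' => by
      linarith [hC.two_increasing v hv v' hv' u hu u' hu' h' h]

lemma mono_left (hC : IsCopula C) (hu : u ∈ I) (hu' : u' ∈ I) (hv : v ∈ I) (h : u ≤ u') :
    C u v ≤ C u' v := by
  have := hC.two_increasing u hu u' hu' 0 unitInterval.zero_mem v hv h hv.1
  rw [hC.grounded_right u hu, hC.grounded_right u' hu'] at this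
  linarith

lemma sub_left_le (hC : IsCopula C) (hu : u ∈ I) (hu' : u' ∈ I) (hv : v ∈ I) (h : u ≤ u') :
    C u' v - C u v ≤ u' - u := by
  have := hC.two_increasing u hu u' hu' v hv 1 unitInterval.one_mem h hv.2
  rw [hC.marginal_right u hu, hC.marginal_right u' hu'] at this
  linarith

lemma congr (hC : IsCopula C) (h : ∀ u ∈ I, ∀ v ∈ I, C u v = D u v) : IsCopula D :=
  of_two_increasing
    (fun v hv => h 0 unitInterval.zero_mem v hv ▸ hC.grounded_left v hv)
    (fun u hu => h u hu 0 unitInterval.zero_mem ▸ hC.grounded_right u hu)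
    (fun v hv => h 1 unitInterval.one_mem v hv ▸ hC.marginal_left v hv)
    (fun u hu => h u hu 1 unitInterval.one_mem ▸ hC.marginal_right u hu)
    fun u hu u' hu' v hv v' hv' h_u h_v => by
      rw [← h u hu v hv, ← h u' hu' v' hv', ← h u hu v' hv', ← h u' hu' v hv]
      exact hC.two_increasing u hu u' hu' v hv v' hv' h_u h_v

end IsCopula

/-- The extension of a function on the unit square to the plane that is constant along the
retraction onto the square. It makes the regularity of a copula, whose values outside the square
are arbitrary, available globally. -/
def unitExtension (C : ℝ → ℝ → ℝ) (u v : ℝ) : ℝ :=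
  C (projIcc 0 1 zero_le_one u) (projIcc 0 1 zero_le_one v)

section unitExtension

variable {C : ℝ → ℝ → ℝ} {u v : ℝ}

lemma unitExtension_of_mem (C : ℝ → ℝ → ℝ) (hu : u ∈ I) (hv : v ∈ I) :
    unitExtension C u v = C u v := by
  rw [unitExtension, projIcc_of_mem _ hu, projIcc_of_mem _ hv]

namespace IsCopula

lemma monotone_unitExtension (hC : IsCopula C) (v : ℝ) : Monotone fun u => unitExtension C u v :=
  fun _ _ h => hC.mono_left (Subtype.coe_prop _) (Subtype.coe_prop _) (Subtype.coe_prop _)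
    (monotone_projIcc _ h)

lemma lipschitzWith_unitExtension (hC : IsCopula C) (v : ℝ) :
    LipschitzWith 1 fun u => unitExtension C u v := by
  refine LipschitzWith.of_le_add fun u u' => ?_
  rcases le_total u u' with h | h
  · linarith [hC.monotone_unitExtension v h, dist_nonneg (x := u) (y := u')]
  · have h_sub := hC.sub_left_le (Subtype.coe_prop _) (Subtype.coe_prop _)
      (Subtype.coe_prop (projIcc 0 1 zero_le_one v)) (monotone_projIcc zero_le_one h)
    have h_proj := (le_abs_self _).trans (abs_projIcc_sub_projIcc (c := u) (d := u') zero_le_one)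
    rw [Real.dist_eq]
    unfold unitExtension
    linarith

lemma continuous_unitExtension (hC : IsCopula C) : Continuous (unitExtension C).uncurry :=
  (LipschitzWith.uncurry hC.lipschitzWith_unitExtension
    hC.swap.lipschitzWith_unitExtension).continuous

lemma continuousOn (hC : IsCopula C) : ContinuousOn C.uncurry (I ×ˢ I) :=
  hC.continuous_unitExtension.continuousOn.congr fun _ hp => (unitExtension_of_mem C hp.1 hp.2).symm

lemma continuousOn_left (hC : IsCopula C) (hv : v ∈ I) : ContinuousOn (fun u => C u v) I :=
  (hC.lipschitzWith_unitExtension v).continuous.continuousOn.congr fun _ hu =>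
    (unitExtension_of_mem C hu hv).symm

end IsCopula

end unitExtension

/-- The partial derivative `∂₁ C(t, v)`, with `v` as the first argument, of the extension of `C` to
the plane. -/
def fstDeriv (C : ℝ → ℝ → ℝ) (v t : ℝ) : ℝ := deriv (fun s => unitExtension C s v) t

section fstDeriv

variable {C D : ℝ → ℝ → ℝ} {u v t : ℝ}

lemma fstDeriv_eq_deriv (C : ℝ → ℝ → ℝ) (hv : v ∈ I) (ht : t ∈ Ioo (0 : ℝ) 1) :
    fstDeriv C v t = deriv (fun s => C s v) t := by
  refine Filter.EventuallyEq.deriv_eq ?_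
  filter_upwards [isOpen_Ioo.mem_nhds ht] with s hs
  exact unitExtension_of_mem C (Ioo_subset_Icc_self hs) hv

lemma fstDeriv_congr (h : ∀ u ∈ I, ∀ v ∈ I, C u v = D u v) : fstDeriv C = fstDeriv D := by
  have h_ext : unitExtension C = unitExtension D :=
    funext₂ fun u v => h _ (Subtype.coe_prop _) _ (Subtype.coe_prop _)
  unfold fstDeriv
  rw [h_ext]

lemma chatterjeeXi_eq (C : ℝ → ℝ → ℝ) :
    chatterjeeXi C = 6 * (∫ v in (0 : ℝ)..1, ∫ t in (0 : ℝ)..1, fstDeriv C v t ^ 2) - 2 := by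
  unfold chatterjeeXi
  congr 2
  refine intervalIntegral.integral_congr fun v hv => ?_
  rw [uIcc_of_le zero_le_one] at hv
  refine intervalIntegral.integral_congr_Ioo_of_le zero_le_one fun t ht => ?_
  simp only [fstDeriv_eq_deriv C hv ht]

lemma chatterjeeXi_congr (h : ∀ u ∈ I, ∀ v ∈ I, C u v = D u v) :
    chatterjeeXi C = chatterjeeXi D := by
  rw [chatterjeeXi_eq, chatterjeeXi_eq, fstDeriv_congr h]

lemma spearmanRho_congr (h : ∀ u ∈ I, ∀ v ∈ I, C u v = D u v) :
    spearmanRho C = spearmanRho D := by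
  unfold spearmanRho
  congr 2
  exact setIntegral_congr_fun (measurableSet_Icc.prod measurableSet_Icc)
    fun p hp => h p.1 hp.1 p.2 hp.2

namespace IsCopula

lemma measurable_fstDeriv (hC : IsCopula C) : Measurable (fstDeriv C).uncurry :=
  measurable_deriv_with_param (f := fun v s => unitExtension C s v)
    (hC.continuous_unitExtension.comp continuous_swap)

lemma fstDeriv_mem (hC : IsCopula C) (v t : ℝ) : fstDeriv C v t ∈ I :=
  ⟨(hC.monotone_unitExtension v).deriv_nonneg,
    (le_abs_self _).trans (norm_deriv_le_of_lipschitz (hC.lipschitzWith_unitExtension v))⟩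

lemma absolutelyContinuousOnInterval (hC : IsCopula C) (v a b : ℝ) :
    AbsolutelyContinuousOnInterval (fun u => unitExtension C u v) a b :=
  (hC.lipschitzWith_unitExtension v).lipschitzOnWith.absolutelyContinuousOnInterval

lemma integral_fstDeriv (hC : IsCopula C) (hu : u ∈ I) (hv : v ∈ I) :
    ∫ t in (0 : ℝ)..u, fstDeriv C v t = C u v := by
  have h_ftc := (hC.absolutelyContinuousOnInterval v 0 u).integral_deriv_eq_sub
  rwa [unitExtension_of_mem C hu hv, unitExtension_of_mem C unitInterval.zero_mem hv,
    hC.grounded_left v hv, sub_zero] at h_ftc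

lemma integral_one_sub_mul_fstDeriv (hC : IsCopula C) (hv : v ∈ I) :
    ∫ t in (0 : ℝ)..1, (1 - t) * fstDeriv C v t = ∫ u in (0 : ℝ)..1, C u v := by
  have h_parts := AbsolutelyContinuousOnInterval.integral_mul_deriv_eq_deriv_mul
    (f := fun t : ℝ => 1 - t) (ContDiffOn.absolutelyContinuousOnInterval (by fun_prop))
    (hC.absolutelyContinuousOnInterval v 0 1)
  have h_deriv : deriv (fun t : ℝ => 1 - t) = fun _ => -1 :=
    funext fun t => ((hasDerivAt_id t).const_sub 1).deriv
  rw [unitExtension_of_mem C unitInterval.zero_mem hv, hC.grounded_left v hv, h_deriv] at h_parts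
  simp only [sub_self, zero_mul, mul_zero, neg_mul, one_mul, intervalIntegral.integral_neg,
    zero_sub, neg_neg] at h_parts
  refine h_parts.trans (intervalIntegral.integral_congr fun u hu => ?_)
  rw [uIcc_of_le zero_le_one] at hu
  exact unitExtension_of_mem C hu hv

lemma spearmanRho_eq (hC : IsCopula C) :
    spearmanRho C = 12 * (∫ v in (0 : ℝ)..1, ∫ u in (0 : ℝ)..1, C u v) - 3 := by
  have h_swap : ContinuousOn (fun p : ℝ × ℝ => C p.2 p.1) (I ×ˢ I) := hC.swap.continuousOn
  rw [spearmanRho, Measure.volume_eq_prod, ← setIntegral_prod_swap]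
  simp only [Prod.fst_swap, Prod.snd_swap]
  rw [setIntegral_prod _ (h_swap.integrableOn_compact (isCompact_Icc.prod isCompact_Icc))]
  simp only [intervalIntegral.integral_of_le zero_le_one, integral_Icc_eq_integral_Ioc]

lemma continuous_integral_unitExtension (hC : IsCopula C) :
    Continuous fun v => ∫ u in (0 : ℝ)..1, unitExtension C u v :=
  intervalIntegral.continuous_parametric_intervalIntegral_of_continuous'
    hC.swap.continuous_unitExtension 0 1

lemma intervalIntegrable_integral (hC : IsCopula C) :
    IntervalIntegrable (fun v => ∫ u in (0 : ℝ)..1, C u v) volume 0 1 := by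
  refine (hC.continuous_integral_unitExtension.intervalIntegrable 0 1).congr fun v hv => ?_
  rw [uIoc_of_le zero_le_one] at hv
  refine intervalIntegral.integral_congr fun u hu => ?_
  rw [uIcc_of_le zero_le_one] at hu
  exact unitExtension_of_mem C hu (Ioc_subset_Icc_self hv)

end IsCopula

end fstDeriv

section Integrability

variable {E : Type*} [NormedAddCommGroup E] {M : ℝ}

lemma intervalIntegrable_of_norm_le {μ : Measure ℝ} [IsLocallyFiniteMeasure μ] {f : ℝ → E}
    (hf : AEStronglyMeasurable f μ) (hM : ∀ t, ‖f t‖ ≤ M) (a b : ℝ) :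
    IntervalIntegrable f μ a b :=
  intervalIntegrable_const.mono_fun' hf.restrict (.of_forall hM)

lemma intervalIntegrable_intervalIntegral_of_norm_le [NormedSpace ℝ E] {f : ℝ → ℝ → E}
    (hf : StronglyMeasurable f.uncurry) (hM : ∀ v t, ‖f v t‖ ≤ M) (a b c d : ℝ) :
    IntervalIntegrable (fun v => ∫ t in a..b, f v t) volume c d := by
  have h_meas : StronglyMeasurable fun v => ∫ t in a..b, f v t :=
    hf.integral_prod_right.sub hf.integral_prod_right
  exact intervalIntegrable_of_norm_le h_meas.aestronglyMeasurable
    (fun v => intervalIntegral.norm_integral_le_of_norm_le_const fun t _ => hM v t) c d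

end Integrability

/-- The squared `L²` distance of the first partial derivatives of two functions on the unit
square. It is the remainder term in the inequality relating `ξ` and `ρ`. -/
def fstDerivSqDist (C D : ℝ → ℝ → ℝ) : ℝ :=
  ∫ v in (0 : ℝ)..1, ∫ t in (0 : ℝ)..1, (fstDeriv C v t - fstDeriv D v t) ^ 2

lemma fstDerivSqDist_nonneg (C D : ℝ → ℝ → ℝ) : 0 ≤ fstDerivSqDist C D :=
  intervalIntegral.integral_nonneg zero_le_one fun _ _ =>
    intervalIntegral.integral_nonneg zero_le_one fun _ _ => sq_nonneg _

lemma norm_le_one_of_mem_unitInterval {x : ℝ} (hx : x ∈ I) : ‖x‖ ≤ 1 :=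
  abs_le.2 ⟨by linarith [hx.1], hx.2⟩

namespace IsCopula

variable {C D : ℝ → ℝ → ℝ}

lemma measurable_fstDeriv_right (hC : IsCopula C) (v : ℝ) : Measurable (fstDeriv C v) :=
  hC.measurable_fstDeriv.comp measurable_prodMk_left

lemma norm_fstDeriv_sq_le (hC : IsCopula C) (v t : ℝ) : ‖fstDeriv C v t ^ 2‖ ≤ 1 := by
  rw [norm_pow]
  exact pow_le_one₀ (norm_nonneg _) (norm_le_one_of_mem_unitInterval (hC.fstDeriv_mem v t))

lemma norm_fstDeriv_sub_sq_le (hC : IsCopula C) (hD : IsCopula D) (v t : ℝ) :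
    ‖(fstDeriv C v t - fstDeriv D v t) ^ 2‖ ≤ 1 := by
  obtain ⟨hC0, hC1⟩ := hC.fstDeriv_mem v t
  obtain ⟨hD0, hD1⟩ := hD.fstDeriv_mem v t
  rw [norm_pow]
  exact pow_le_one₀ (norm_nonneg _) (abs_le.2 ⟨by linarith, by linarith⟩)

lemma intervalIntegrable_fstDeriv (hC : IsCopula C) (v a b : ℝ) :
    IntervalIntegrable (fstDeriv C v) volume a b :=
  intervalIntegrable_of_norm_le (hC.measurable_fstDeriv_right v).aestronglyMeasurable
    (fun t => norm_le_one_of_mem_unitInterval (hC.fstDeriv_mem v t)) a b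

lemma intervalIntegrable_fstDeriv_sq (hC : IsCopula C) (v a b : ℝ) :
    IntervalIntegrable (fun t => fstDeriv C v t ^ 2) volume a b :=
  intervalIntegrable_of_norm_le ((hC.measurable_fstDeriv_right v).pow_const 2).aestronglyMeasurable
    (hC.norm_fstDeriv_sq_le v) a b

lemma intervalIntegrable_integral_fstDeriv_sq (hC : IsCopula C) (a b c d : ℝ) :
    IntervalIntegrable (fun v => ∫ t in a..b, fstDeriv C v t ^ 2) volume c d :=
  intervalIntegrable_intervalIntegral_of_norm_le (f := fun v t => fstDeriv C v t ^ 2)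
    (hC.measurable_fstDeriv.pow_const 2).stronglyMeasurable hC.norm_fstDeriv_sq_le a b c d

lemma intervalIntegrable_fstDeriv_sub_sq (hC : IsCopula C) (hD : IsCopula D) (v a b : ℝ) :
    IntervalIntegrable (fun t => (fstDeriv C v t - fstDeriv D v t) ^ 2) volume a b :=
  intervalIntegrable_of_norm_le (((hC.measurable_fstDeriv_right v).sub
    (hD.measurable_fstDeriv_right v)).pow_const 2).aestronglyMeasurable
    (hC.norm_fstDeriv_sub_sq_le hD v) a b

lemma intervalIntegrable_integral_fstDeriv_sub_sq (hC : IsCopula C) (hD : IsCopula D)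
    (a b c d : ℝ) :
    IntervalIntegrable (fun v => ∫ t in a..b, (fstDeriv C v t - fstDeriv D v t) ^ 2)
      volume c d :=
  intervalIntegrable_intervalIntegral_of_norm_le
    (f := fun v t => (fstDeriv C v t - fstDeriv D v t) ^ 2)
    ((hC.measurable_fstDeriv.sub hD.measurable_fstDeriv).pow_const 2).stronglyMeasurable
    (hC.norm_fstDeriv_sub_sq_le hD) a b c d

lemma eq_of_integral_fstDeriv_sub_sq_eq_zero (hC : IsCopula C) (hD : IsCopula D) {u v : ℝ}
    (hu : u ∈ I) (hv : v ∈ I)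
    (h : ∫ t in (0 : ℝ)..1, (fstDeriv C v t - fstDeriv D v t) ^ 2 = 0) : C u v = D u v := by
  rw [intervalIntegral.integral_eq_zero_iff_of_le_of_nonneg_ae zero_le_one
    (.of_forall fun t => sq_nonneg _) (hC.intervalIntegrable_fstDeriv_sub_sq hD v 0 1)] at h
  rw [← hC.integral_fstDeriv hu hv, ← hD.integral_fstDeriv hu hv]
  refine intervalIntegral.integral_congr_ae ?_
  rw [uIoc_of_le hu.1]
  filter_upwards [(ae_restrict_iff' measurableSet_Ioc).1 h] with t ht htu
  exact sub_eq_zero.1 (pow_eq_zero_iff two_ne_zero |>.1 (ht ⟨htu.1, htu.2.trans hu.2⟩))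

theorem eq_of_fstDerivSqDist_eq_zero (hC : IsCopula C) (hD : IsCopula D)
    (h : fstDerivSqDist C D = 0) {u v : ℝ} (hu : u ∈ I) (hv : v ∈ I) : C u v = D u v := by
  rw [fstDerivSqDist, intervalIntegral.integral_eq_zero_iff_of_le_of_nonneg_ae zero_le_one
    (.of_forall fun v => intervalIntegral.integral_nonneg zero_le_one fun t _ => sq_nonneg _)
    (hC.intervalIntegrable_integral_fstDeriv_sub_sq hD 0 1 0 1)] at h
  have h_ae : C u =ᵐ[volume.restrict I] D u := by
    rw [← restrict_Ioc_eq_restrict_Icc]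
    filter_upwards [h, ae_restrict_mem measurableSet_Ioc] with v h0 hv
    exact hC.eq_of_integral_fstDeriv_sub_sq_eq_zero hD hu (Ioc_subset_Icc_self hv) h0
  exact Measure.eqOn_Icc_of_ae_eq volume zero_ne_one h_ae (hC.swap.continuousOn_left hu)
    (hD.swap.continuousOn_left hu) hv

end IsCopula

/-- The linear function `t ↦ b (s - t)` truncated to the unit interval. -/
def clampedRamp (b s t : ℝ) : ℝ := min (max (b * (s - t)) 0) 1

section clampedRamp

variable {b s t : ℝ} {k : ℝ → ℝ}

@[fun_prop]
lemma continuous_clampedRamp (b s : ℝ) : Continuous (clampedRamp b s) := by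
  unfold clampedRamp; fun_prop

lemma clampedRamp_mem (b s t : ℝ) : clampedRamp b s t ∈ I :=
  ⟨le_min (le_max_right _ _) zero_le_one, min_le_right _ _⟩

lemma clampedRamp_mono (hb : 0 ≤ b) {s' : ℝ} (h : s ≤ s') (t : ℝ) :
    clampedRamp b s t ≤ clampedRamp b s' t :=
  min_le_min_right _ (max_le_max_right _ (mul_le_mul_of_nonneg_left (by linarith) hb))

/-- The truncation is the metric projection onto `[0,1]`, characterized by this variational
inequality. -/
lemma clampedRamp_sub_mul_nonneg (b s t : ℝ) {x : ℝ} (hx : x ∈ I) :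
    0 ≤ (clampedRamp b s t - b * (s - t)) * (x - clampedRamp b s t) := by
  obtain ⟨h0, h1⟩ := hx
  unfold clampedRamp
  rcases le_total (b * (s - t)) 0 with h | h
  · rw [max_eq_right h, min_eq_left zero_le_one]
    exact mul_nonneg (by linarith) (by linarith)
  rw [max_eq_left h]
  rcases le_total (b * (s - t)) 1 with h' | h'
  · rw [min_eq_left h', sub_self, zero_mul]
  · rw [min_eq_right h']
    exact mul_nonneg_of_nonpos_of_nonpos (by linarith) (by linarith)

lemma integral_sub_sq {f g : ℝ → ℝ} {a b : ℝ}
    (hf : IntervalIntegrable (fun t => f t ^ 2) volume a b)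
    (hfg : IntervalIntegrable (fun t => g t * f t) volume a b)
    (hg : IntervalIntegrable (fun t => g t ^ 2) volume a b) :
    ∫ t in a..b, (f t - g t) ^ 2 =
      (∫ t in a..b, f t ^ 2) - 2 * (∫ t in a..b, g t * f t) + ∫ t in a..b, g t ^ 2 := by
  rw [← intervalIntegral.integral_const_mul, ← intervalIntegral.integral_sub hf (hfg.const_mul 2),
    ← intervalIntegral.integral_add (hf.sub (hfg.const_mul 2)) hg]
  exact intervalIntegral.integral_congr fun t _ => by ring

lemma integral_clampedRamp_sq_le_integral_mul (b s : ℝ) (hk : IntervalIntegrable k volume 0 1)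
    (hkI : ∀ t, k t ∈ I) (h_mean : ∫ t in (0 : ℝ)..1, k t = ∫ t in (0 : ℝ)..1, clampedRamp b s t) :
    (∫ t in (0 : ℝ)..1, clampedRamp b s t ^ 2)
      + b * ((∫ t in (0 : ℝ)..1, (1 - t) * k t)
        - ∫ t in (0 : ℝ)..1, (1 - t) * clampedRamp b s t) ≤
      ∫ t in (0 : ℝ)..1, clampedRamp b s t * k t := by
  set r := clampedRamp b s
  have hr : Continuous r := continuous_clampedRamp b s
  have h_prod : IntervalIntegrable (fun t => r t * k t) volume 0 1 :=
    hk.continuousOn_mul hr.continuousOn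
  have h_sq : IntervalIntegrable (fun t => r t ^ 2) volume 0 1 := (hr.pow 2).intervalIntegrable 0 1
  have h_lin_k : IntervalIntegrable (fun t => (1 - t) * k t) volume 0 1 :=
    hk.continuousOn_mul (by fun_prop)
  have h_lin_r : IntervalIntegrable (fun t => (1 - t) * r t) volume 0 1 :=
    Continuous.intervalIntegrable (by fun_prop) 0 1
  have h_ramp : IntervalIntegrable r volume 0 1 := hr.intervalIntegrable 0 1
  have h_proj : 0 ≤ (∫ t in (0 : ℝ)..1, r t * k t) - (∫ t in (0 : ℝ)..1, r t ^ 2)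
      - b * ((∫ t in (0 : ℝ)..1, (1 - t) * k t) - ∫ t in (0 : ℝ)..1, (1 - t) * r t)
      - b * (s - 1) * ((∫ t in (0 : ℝ)..1, k t) - ∫ t in (0 : ℝ)..1, r t) := by
    rw [← intervalIntegral.integral_sub h_prod h_sq,
      ← intervalIntegral.integral_sub h_lin_k h_lin_r, ← intervalIntegral.integral_sub hk h_ramp,
      ← intervalIntegral.integral_const_mul, ← intervalIntegral.integral_const_mul,
      ← intervalIntegral.integral_sub (h_prod.sub h_sq) ((h_lin_k.sub h_lin_r).const_mul b),
      ← intervalIntegral.integral_sub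
        ((h_prod.sub h_sq).sub ((h_lin_k.sub h_lin_r).const_mul b)) ((hk.sub h_ramp).const_mul _)]
    exact intervalIntegral.integral_nonneg zero_le_one fun t _ =>
      (clampedRamp_sub_mul_nonneg b s t (hkI t)).trans_eq (by simp only [r]; ring)
  rw [h_mean, sub_self, mul_zero, sub_zero] at h_proj
  linarith

theorem integral_clampedRamp_sq_add_le (b s : ℝ) (hk : Measurable k) (hkI : ∀ t, k t ∈ I)
    (h_mean : ∫ t in (0 : ℝ)..1, k t = ∫ t in (0 : ℝ)..1, clampedRamp b s t) :
    (∫ t in (0 : ℝ)..1, clampedRamp b s t ^ 2)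
      + 2 * b * ((∫ t in (0 : ℝ)..1, (1 - t) * k t)
        - ∫ t in (0 : ℝ)..1, (1 - t) * clampedRamp b s t)
      + ∫ t in (0 : ℝ)..1, (k t - clampedRamp b s t) ^ 2 ≤ ∫ t in (0 : ℝ)..1, k t ^ 2 := by
  have hr : Continuous (clampedRamp b s) := continuous_clampedRamp b s
  have h_int : IntervalIntegrable k volume 0 1 := intervalIntegrable_of_norm_le
    hk.aestronglyMeasurable (fun t => norm_le_one_of_mem_unitInterval (hkI t)) 0 1
  have h_sq : IntervalIntegrable (fun t => k t ^ 2) volume 0 1 :=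
    intervalIntegrable_of_norm_le (M := 1) (hk.pow_const 2).aestronglyMeasurable
      (fun t => by
        rw [norm_pow]
        exact pow_le_one₀ (norm_nonneg _) (norm_le_one_of_mem_unitInterval (hkI t))) 0 1
  rw [integral_sub_sq h_sq (h_int.continuousOn_mul hr.continuousOn)
    ((hr.pow 2).intervalIntegrable 0 1)]
  linarith [integral_clampedRamp_sq_le_integral_mul b s h_int hkI h_mean]

lemma mul_posPart_of_nonneg (hb : 0 ≤ b) (t : ℝ) : b * t⁺ = (b * t)⁺ := by
  simp only [posPart_def, mul_max_of_nonneg _ _ hb, mul_zero]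

lemma mul_posPart_sub (hb : 0 < b) (s t : ℝ) :
    b * (s - 1 / b - t)⁺ = (b * (s - t) - 1)⁺ := by
  rw [mul_posPart_of_nonneg hb.le]
  congr 1
  field_simp
  ring

lemma clampedRamp_eq_posPart (hb : 0 < b) (s t : ℝ) :
    clampedRamp b s t = b * (s - t)⁺ - b * (s - 1 / b - t)⁺ := by
  rw [mul_posPart_sub hb, mul_posPart_of_nonneg hb.le, clampedRamp]
  simp only [posPart_def]
  grind

lemma clampedRamp_sq_eq_posPart (hb : 0 < b) (s t : ℝ) :
    clampedRamp b s t ^ 2 =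
      b ^ 2 * (s - t)⁺ ^ 2 - b ^ 2 * (s - 1 / b - t)⁺ ^ 2 - 2 * b * (s - 1 / b - t)⁺ := by
  rw [← mul_pow, ← mul_pow, mul_assoc 2 b, mul_posPart_sub hb, mul_posPart_of_nonneg hb.le,
    clampedRamp]
  simp only [posPart_def]
  rcases le_total (b * (s - t)) 0 with h | h
  · rw [max_eq_right h, max_eq_right (by linarith)]; simp
  rcases le_total (b * (s - t)) 1 with h' | h'
  · rw [max_eq_left h, max_eq_right (by linarith), min_eq_left h']; ring
  · rw [max_eq_left h, max_eq_left (by linarith), min_eq_right h']; ring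

lemma integral_posPart_pow {n : ℕ} (hn : n ≠ 0) (a b : ℝ) :
    ∫ x in a..b, x⁺ ^ n = (b⁺ ^ (n + 1) - a⁺ ^ (n + 1)) / (n + 1) := by
  have h_zero : ∀ c : ℝ, ∫ x in (0 : ℝ)..c, x⁺ ^ n = c⁺ ^ (n + 1) / (n + 1) := by
    intro c
    rcases le_total 0 c with hc | hc
    · have h_pow : EqOn (fun x : ℝ => x⁺ ^ n) (fun x => x ^ n) (uIcc 0 c) := fun x hx => by
        rw [uIcc_of_le hc] at hx
        simp only [posPart_eq_self.2 hx.1]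
      rw [posPart_eq_self.2 hc, intervalIntegral.integral_congr h_pow, integral_pow,
        zero_pow n.succ_ne_zero, sub_zero]
    · rw [posPart_eq_zero.2 hc, zero_pow n.succ_ne_zero, zero_div]
      have h_vanish : EqOn (fun x : ℝ => x⁺ ^ n) (fun _ => 0) (uIcc 0 c) := fun x hx => by
        rw [uIcc_of_ge hc] at hx
        simp only [posPart_eq_zero.2 hx.2, zero_pow hn]
      rw [intervalIntegral.integral_congr h_vanish, intervalIntegral.integral_zero]
  have hi : ∀ c d : ℝ, IntervalIntegrable (fun x : ℝ => x⁺ ^ n) volume c d := fun c d =>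
    Continuous.intervalIntegrable (by fun_prop) c d
  rw [← intervalIntegral.integral_interval_sub_left (hi 0 b) (hi 0 a), h_zero, h_zero, sub_div]

lemma integral_posPart_sub_left_pow {n : ℕ} (hn : n ≠ 0) (s : ℝ) :
    ∫ t in (0 : ℝ)..1, (s - t)⁺ ^ n = (s⁺ ^ (n + 1) - (s - 1)⁺ ^ (n + 1)) / (n + 1) := by
  rw [intervalIntegral.integral_comp_sub_left (fun x => x⁺ ^ n) s, integral_posPart_pow hn,
    sub_zero]

lemma integral_posPart_sub_left (s : ℝ) :
    ∫ t in (0 : ℝ)..1, (s - t)⁺ = (s⁺ ^ 2 - (s - 1)⁺ ^ 2) / 2 := by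
  simpa only [pow_one, Nat.cast_one, one_add_one_eq_two] using
    integral_posPart_sub_left_pow one_ne_zero s

lemma integral_posPart_sub_left_sq (s : ℝ) :
    ∫ t in (0 : ℝ)..1, (s - t)⁺ ^ 2 = (s⁺ ^ 3 - (s - 1)⁺ ^ 3) / 3 := by
  simpa only [Nat.cast_ofNat, Nat.reduceAdd, two_add_one_eq_three] using
    integral_posPart_sub_left_pow two_ne_zero s

lemma integral_one_sub_mul_posPart_sub_left (s : ℝ) :
    ∫ t in (0 : ℝ)..1, (1 - t) * (s - t)⁺ =
      (s⁺ ^ 3 - (s - 1)⁺ ^ 3) / 3 + (1 - s) * ((s⁺ ^ 2 - (s - 1)⁺ ^ 2) / 2) := by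
  have h_split : ∀ t : ℝ, (1 - t) * (s - t)⁺ = (s - t)⁺ ^ 2 + (1 - s) * (s - t)⁺ := by
    intro t
    have : (s - t) * (s - t)⁺ = (s - t)⁺ ^ 2 := by
      rcases le_total 0 (s - t) with h | h
      · rw [posPart_eq_self.2 h, sq]
      · rw [posPart_eq_zero.2 h]; ring
    rw [← this]; ring
  simp only [h_split]
  rw [intervalIntegral.integral_add (Continuous.intervalIntegrable (by fun_prop) _ _)
      (Continuous.intervalIntegrable (by fun_prop) _ _), intervalIntegral.integral_const_mul,
    integral_posPart_sub_left_sq, integral_posPart_sub_left]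

lemma integral_clampedRamp (hb : 0 < b) (s : ℝ) :
    ∫ t in (0 : ℝ)..1, clampedRamp b s t =
      b / 2 * (s⁺ ^ 2 - (s - 1)⁺ ^ 2 - (s - 1 / b)⁺ ^ 2 + (s - 1 / b - 1)⁺ ^ 2) := by
  simp only [clampedRamp_eq_posPart hb]
  rw [intervalIntegral.integral_sub (Continuous.intervalIntegrable (by fun_prop) _ _)
      (Continuous.intervalIntegrable (by fun_prop) _ _),
    intervalIntegral.integral_const_mul, intervalIntegral.integral_const_mul,
    integral_posPart_sub_left, integral_posPart_sub_left]
  ring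

lemma integral_clampedRamp_sq (hb : 0 < b) (s : ℝ) :
    ∫ t in (0 : ℝ)..1, clampedRamp b s t ^ 2 =
      b ^ 2 / 3 * (s⁺ ^ 3 - (s - 1)⁺ ^ 3 - (s - 1 / b)⁺ ^ 3 + (s - 1 / b - 1)⁺ ^ 3)
        - b * ((s - 1 / b)⁺ ^ 2 - (s - 1 / b - 1)⁺ ^ 2) := by
  simp only [clampedRamp_sq_eq_posPart hb]
  rw [intervalIntegral.integral_sub (Continuous.intervalIntegrable (by fun_prop) _ _)
      (Continuous.intervalIntegrable (by fun_prop) _ _),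
    intervalIntegral.integral_sub (Continuous.intervalIntegrable (by fun_prop) _ _)
      (Continuous.intervalIntegrable (by fun_prop) _ _), intervalIntegral.integral_const_mul,
    intervalIntegral.integral_const_mul, intervalIntegral.integral_const_mul,
    integral_posPart_sub_left_sq, integral_posPart_sub_left_sq, integral_posPart_sub_left]
  ring

lemma integral_one_sub_mul_clampedRamp (hb : 0 < b) (s : ℝ) :
    ∫ t in (0 : ℝ)..1, (1 - t) * clampedRamp b s t =
      b * ((s⁺ ^ 3 - (s - 1)⁺ ^ 3) / 3 + (1 - s) * ((s⁺ ^ 2 - (s - 1)⁺ ^ 2) / 2))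
      - b * (((s - 1 / b)⁺ ^ 3 - (s - 1 / b - 1)⁺ ^ 3) / 3
        + (1 - (s - 1 / b)) * (((s - 1 / b)⁺ ^ 2 - (s - 1 / b - 1)⁺ ^ 2) / 2)) := by
  have h_split : ∀ t, (1 - t) * clampedRamp b s t =
      b * ((1 - t) * (s - t)⁺) - b * ((1 - t) * (s - 1 / b - t)⁺) := fun t => by
    rw [clampedRamp_eq_posPart hb]; ring
  simp only [h_split]
  rw [intervalIntegral.integral_sub (Continuous.intervalIntegrable (by fun_prop) _ _)
      (Continuous.intervalIntegrable (by fun_prop) _ _), intervalIntegral.integral_const_mul,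
    intervalIntegral.integral_const_mul, integral_one_sub_mul_posPart_sub_left,
    integral_one_sub_mul_posPart_sub_left]

end clampedRamp

theorem isCopula_integral {h : ℝ → ℝ → ℝ} (hi : ∀ v ∈ I, IntervalIntegrable (h v) volume 0 1)
    (hI : ∀ v ∈ I, ∀ t ∈ I, h v t ∈ I) (h_mean : ∀ v ∈ I, ∫ t in (0 : ℝ)..1, h v t = v)
    (h_mono : ∀ v ∈ I, ∀ v' ∈ I, v ≤ v' → ∀ t ∈ I, h v t ≤ h v' t) :
    IsCopula fun u v => ∫ t in (0 : ℝ)..u, h v t := by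
  have hi' : ∀ v ∈ I, ∀ a ∈ I, ∀ b ∈ I, IntervalIntegrable (h v) volume a b :=
    fun v hv a ha b hb => (hi v hv).mono_set
      (uIcc_subset_uIcc (by simpa using ha) (by simpa using hb))
  have h0 := unitInterval.zero_mem
  have h1 := unitInterval.one_mem
  have h_sub : ∀ v ∈ I, ∀ u ∈ I, ∀ u' ∈ I,
      (∫ t in (0 : ℝ)..u', h v t) - (∫ t in (0 : ℝ)..u, h v t) = ∫ t in u..u', h v t :=
    fun v hv u hu u' hu' => intervalIntegral.integral_interval_sub_left
      (hi' v hv 0 h0 u' hu') (hi' v hv 0 h0 u hu)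
  have h_nonneg : ∀ v ∈ I, ∀ u ∈ I, ∀ u' ∈ I, u ≤ u' → 0 ≤ ∫ t in u..u', h v t :=
    fun v hv u hu u' hu' huu => intervalIntegral.integral_nonneg huu
      fun t ht => (hI v hv t ⟨hu.1.trans ht.1, ht.2.trans hu'.2⟩).1
  have h_le : ∀ v ∈ I, ∀ u ∈ I, ∀ u' ∈ I, u ≤ u' → ∫ t in u..u', h v t ≤ u' - u :=
    fun v hv u hu u' hu' huu => by
      simpa using intervalIntegral.integral_mono_on huu (hi' v hv u hu u' hu')
        intervalIntegrable_const fun t ht => (hI v hv t ⟨hu.1.trans ht.1, ht.2.trans hu'.2⟩).2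
  refine .of_two_increasing (fun v _ => intervalIntegral.integral_same) (fun u hu => ?_) h_mean
    (fun u hu => ?_) fun u hu u' hu' v hv v' hv' huu hvv => ?_
  · have h_right := h_nonneg 0 h0 u hu 1 h1 hu.2
    rw [← h_sub 0 h0 u hu 1 h1, h_mean 0 h0] at h_right
    linarith [h_nonneg 0 h0 0 h0 u hu hu.1]
  · have h_right := h_le 1 h1 u hu 1 h1 hu.2
    rw [← h_sub 1 h1 u hu 1 h1, h_mean 1 h1] at h_right
    linarith [h_le 1 h1 0 h0 u hu hu.1]
  · have h_int := intervalIntegral.integral_mono_on huu (hi' v hv u hu u' hu')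
      (hi' v' hv' u hu u' hu')
      fun t ht => h_mono v hv v' hv' hvv t ⟨hu.1.trans ht.1, ht.2.trans hu'.2⟩
    linarith [h_sub v hv u hu u' hu', h_sub v' hv' u hu u' hu']

/-- The point at which `v ↦ bandMax b v` switches from its first to its second branch; by
symmetry the last branch starts at `1 - bandSplit b`. -/
def bandSplit (b : ℝ) : ℝ := min (1 / (2 * b)) (b / 2)

section bandMax

variable {b v : ℝ}

lemma bandSplit_of_one_le (hb : 1 ≤ b) : bandSplit b = 1 / (2 * b) :=
  min_eq_left (by rw [div_le_div_iff₀ (by linarith) two_pos]; nlinarith)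

lemma bandSplit_of_le_one (hb : 0 < b) (hb1 : b ≤ 1) : bandSplit b = b / 2 :=
  min_eq_right (by rw [div_le_div_iff₀ two_pos (by linarith)]; nlinarith)

lemma bandSplit_pos (hb : 0 < b) : 0 < bandSplit b := lt_min (by positivity) (by positivity)

lemma bandSplit_le_half (hb : 0 < b) : bandSplit b ≤ 1 / 2 := by
  rcases le_total 1 b with h | h
  · rw [bandSplit_of_one_le h, div_le_div_iff₀ (by linarith) two_pos]; linarith
  · rw [bandSplit_of_le_one hb h]; linarith

lemma half_le_one_div_two_mul (hb : 0 < b) (hb1 : b ≤ 1) : 1 / 2 ≤ 1 / (2 * b) := by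
  rw [div_le_div_iff₀ two_pos (by linarith)]; linarith

lemma bandMax_low (hv : v ≤ bandSplit b) : bandMax b v = √(2 * v / b) := by
  rw [bandMax, if_pos]
  rcases le_total 1 b with h | h
  · exact .inl ⟨h, hv.trans (min_le_left _ _)⟩
  · exact .inr ⟨h, hv.trans (min_le_right _ _)⟩

lemma bandMax_middle_of_one_le (hb : 1 ≤ b) (h1 : 1 / (2 * b) < v) (h2 : v ≤ 1 - 1 / (2 * b)) :
    bandMax b v = v + 1 / (2 * b) := by
  rw [bandMax, if_neg, if_pos ⟨h1, h2⟩]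
  rintro (⟨-, h⟩ | ⟨h, h'⟩)
  · linarith
  · obtain rfl : b = 1 := le_antisymm h hb
    norm_num at *; linarith

lemma bandMax_middle_of_le_one (hb : 0 < b) (hb1 : b ≤ 1) (h1 : b / 2 < v) (h2 : v ≤ 1 - b / 2) :
    bandMax b v = v / b + 1 / 2 := by
  have := half_le_one_div_two_mul hb hb1
  rw [bandMax, if_neg, if_neg, if_pos ⟨h1, h2⟩]
  · rintro ⟨h, h'⟩; linarith
  · rintro (⟨h, h'⟩ | ⟨-, h⟩)
    · obtain rfl : b = 1 := le_antisymm hb1 h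
      norm_num at *; linarith
    · linarith

lemma bandMax_high (hb : 0 < b) (hv : 1 - bandSplit b < v) :
    bandMax b v = 1 + 1 / b - √(2 * (1 - v) / b) := by
  have hs := bandSplit_le_half hb
  rcases le_total 1 b with h | h
  · rw [bandSplit_of_one_le h] at hv hs
    rw [bandMax, if_neg, if_neg, if_neg]
    · exact fun h' => by linarith [h'.2]
    · exact fun h' => by linarith [h'.2]
    · rintro (h' | h') <;> linarith [h'.1, h'.2]
  · rw [bandSplit_of_le_one hb h] at hv hs
    have := half_le_one_div_two_mul hb h
    rw [bandMax, if_neg, if_neg, if_neg]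
    · exact fun h' => by linarith [h'.2]
    · exact fun h' => by linarith [h'.1, h'.2]
    · rintro (⟨h1, h2⟩ | ⟨-, h2⟩)
      · obtain rfl : b = 1 := le_antisymm h h1
        norm_num at *; linarith
      · linarith

lemma sqrt_le_one_of_le_bandSplit (hb : 0 < b) (hv : v ≤ bandSplit b) : √(2 * v / b) ≤ 1 := by
  have := hv.trans (min_le_right _ _)
  exact Real.sqrt_le_one.2 ((div_le_one hb).2 (by linarith))

lemma sqrt_le_one_div_of_le_bandSplit (hb : 0 < b) (hv : v ≤ bandSplit b) :
    √(2 * v / b) ≤ 1 / b := by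
  have h_le := hv.trans (min_le_left _ _)
  rw [le_div_iff₀ (by linarith)] at h_le
  refine Real.sqrt_le_iff.2 ⟨by positivity, ?_⟩
  field_simp
  linarith

lemma moments_low (hb : 0 < b) (h0 : 0 ≤ v) (hv : v ≤ bandSplit b) :
    (∫ t in (0 : ℝ)..1, clampedRamp b (bandMax b v) t) = v ∧
    (∫ t in (0 : ℝ)..1, clampedRamp b (bandMax b v) t ^ 2) = b ^ 2 / 3 * √(2 * v / b) ^ 3 ∧
    (∫ t in (0 : ℝ)..1, (1 - t) * clampedRamp b (bandMax b v) t) =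
      v - b / 6 * √(2 * v / b) ^ 3 := by
  have h_one := sqrt_le_one_of_le_bandSplit hb hv
  have h_inv := sqrt_le_one_div_of_le_bandSplit hb hv
  have h_v : v = b * √(2 * v / b) ^ 2 / 2 := by
    rw [Real.sq_sqrt (by positivity)]; field_simp
  rw [bandMax_low hv, integral_clampedRamp hb, integral_clampedRamp_sq hb,
    integral_one_sub_mul_clampedRamp hb, posPart_eq_self.2 (Real.sqrt_nonneg _),
    posPart_eq_zero.2 (sub_nonpos.2 h_one), posPart_eq_zero.2 (sub_nonpos.2 h_inv),
    posPart_eq_zero.2 (by linarith : √(2 * v / b) - 1 / b - 1 ≤ 0)]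
  exact ⟨by linear_combination -h_v, by ring, by linear_combination -h_v⟩

lemma moments_middle_of_one_le (hb : 1 ≤ b) (h1 : 1 / (2 * b) < v)
    (h2 : v ≤ 1 - 1 / (2 * b)) :
    (∫ t in (0 : ℝ)..1, clampedRamp b (bandMax b v) t) = v ∧
    (∫ t in (0 : ℝ)..1, clampedRamp b (bandMax b v) t ^ 2) = v - 1 / (6 * b) ∧
    (∫ t in (0 : ℝ)..1, (1 - t) * clampedRamp b (bandMax b v) t) =
      v - v ^ 2 / 2 - 1 / (24 * b ^ 2) := by
  have hb0 : 0 < b := by linarith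
  have h_pos : 0 < 1 / (2 * b) := by positivity
  have h_inv : v + 1 / (2 * b) - 1 / b = v - 1 / (2 * b) := by field_simp; ring
  rw [bandMax_middle_of_one_le hb h1 h2, integral_clampedRamp hb0, integral_clampedRamp_sq hb0,
    integral_one_sub_mul_clampedRamp hb0, h_inv,
    posPart_eq_self.2 (by linarith : 0 ≤ v + 1 / (2 * b)),
    posPart_eq_zero.2 (by linarith : v + 1 / (2 * b) - 1 ≤ 0),
    posPart_eq_self.2 (by linarith : 0 ≤ v - 1 / (2 * b)),
    posPart_eq_zero.2 (by linarith : v - 1 / (2 * b) - 1 ≤ 0)]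
  refine ⟨?_, ?_, ?_⟩ <;> field_simp <;> ring

lemma moments_middle_of_le_one (hb : 0 < b) (hb1 : b ≤ 1) (h1 : b / 2 < v)
    (h2 : v ≤ 1 - b / 2) :
    (∫ t in (0 : ℝ)..1, clampedRamp b (bandMax b v) t) = v ∧
    (∫ t in (0 : ℝ)..1, clampedRamp b (bandMax b v) t ^ 2) = v ^ 2 + b ^ 2 / 12 ∧
    (∫ t in (0 : ℝ)..1, (1 - t) * clampedRamp b (bandMax b v) t) = v / 2 + b / 12 := by
  have h_left : 1 / 2 ≤ v / b := by rw [le_div_iff₀ hb]; linarith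
  have h_right : v / b + 1 / 2 - 1 / b ≤ 0 := by
    have : v / b + 1 / 2 - 1 / b = (v + b / 2 - 1) / b := by field_simp
    rw [this]
    exact div_nonpos_of_nonpos_of_nonneg (by linarith) hb.le
  rw [bandMax_middle_of_le_one hb hb1 h1 h2, integral_clampedRamp hb, integral_clampedRamp_sq hb,
    integral_one_sub_mul_clampedRamp hb, posPart_eq_self.2 (by linarith : 0 ≤ v / b + 1 / 2),
    posPart_eq_self.2 (by linarith : 0 ≤ v / b + 1 / 2 - 1), posPart_eq_zero.2 h_right,
    posPart_eq_zero.2 (by linarith : v / b + 1 / 2 - 1 / b - 1 ≤ 0)]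
  refine ⟨?_, ?_, ?_⟩ <;> field_simp <;> ring

lemma moments_high (hb : 0 < b) (h1 : v ≤ 1) (hv : 1 - bandSplit b < v) :
    (∫ t in (0 : ℝ)..1, clampedRamp b (bandMax b v) t) = v ∧
    (∫ t in (0 : ℝ)..1, clampedRamp b (bandMax b v) t ^ 2) =
      2 * v - 1 + b ^ 2 / 3 * √(2 * (1 - v) / b) ^ 3 ∧
    (∫ t in (0 : ℝ)..1, (1 - t) * clampedRamp b (bandMax b v) t) =
      1 / 2 - b / 6 * √(2 * (1 - v) / b) ^ 3 := by
  have h_le : 1 - v ≤ bandSplit b := by linarith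
  have h_one := sqrt_le_one_of_le_bandSplit hb h_le
  have h_inv := sqrt_le_one_div_of_le_bandSplit hb h_le
  have h_v : v = 1 - b * √(2 * (1 - v) / b) ^ 2 / 2 := by
    rw [Real.sq_sqrt (div_nonneg (by linarith) hb.le)]; field_simp; ring
  rw [bandMax_high hb hv, integral_clampedRamp hb, integral_clampedRamp_sq hb,
    integral_one_sub_mul_clampedRamp hb]
  have h_nonneg := Real.sqrt_nonneg (2 * (1 - v) / b)
  generalize √(2 * (1 - v) / b) = r at *
  rw [posPart_eq_self.2 (by linarith : 0 ≤ 1 + 1 / b - r),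
    posPart_eq_self.2 (by linarith : 0 ≤ 1 + 1 / b - r - 1),
    posPart_eq_self.2 (by linarith : 0 ≤ 1 + 1 / b - r - 1 / b),
    posPart_eq_zero.2 (by linarith : 1 + 1 / b - r - 1 / b - 1 ≤ 0), h_v]
  refine ⟨?_, ?_, ?_⟩ <;> field_simp <;> ring

lemma integral_clampedRamp_bandMax (hb : 0 < b) (hv : v ∈ I) :
    ∫ t in (0 : ℝ)..1, clampedRamp b (bandMax b v) t = v := by
  rcases le_or_gt v (bandSplit b) with h_low | h_low
  · exact (moments_low hb hv.1 h_low).1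
  rcases lt_or_ge (1 - bandSplit b) v with h_high | h_high
  · exact (moments_high hb hv.2 h_high).1
  rcases le_total 1 b with hb1 | hb1
  · rw [bandSplit_of_one_le hb1] at h_low h_high
    exact (moments_middle_of_one_le hb1 h_low h_high).1
  · rw [bandSplit_of_le_one hb hb1] at h_low h_high
    exact (moments_middle_of_le_one hb hb1 h_low h_high).1

lemma clampedRamp_bandMax_mono (hb : 0 < b) {v' : ℝ} (hv : v ∈ I) (hv' : v' ∈ I) (h : v ≤ v')
    (t : ℝ) : clampedRamp b (bandMax b v) t ≤ clampedRamp b (bandMax b v') t := by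
  rcases h.eq_or_lt with rfl | h_lt
  · exact le_rfl
  refine clampedRamp_mono hb.le (le_of_not_gt fun h_gt => h_lt.not_ge ?_) t
  rw [← integral_clampedRamp_bandMax hb hv, ← integral_clampedRamp_bandMax hb hv']
  exact intervalIntegral.integral_mono zero_le_one
    ((continuous_clampedRamp _ _).intervalIntegrable _ _)
    ((continuous_clampedRamp _ _).intervalIntegrable _ _) (clampedRamp_mono hb.le h_gt.le)

theorem isCopula_bandCopulaPos (hb : 0 < b) : IsCopula (bandCopulaPos b) :=
  isCopula_integral (h := fun v => clampedRamp b (bandMax b v))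
    (fun _ _ => (continuous_clampedRamp _ _).intervalIntegrable _ _)
    (fun _ _ t _ => clampedRamp_mem _ _ t) (fun _ hv => integral_clampedRamp_bandMax hb hv)
    fun _ hv _ hv' h t _ => clampedRamp_bandMax_mono hb hv hv' h t

lemma fstDeriv_bandCopulaPos (b : ℝ) {t : ℝ} (hv : v ∈ I) (ht : t ∈ Ioo (0 : ℝ) 1) :
    fstDeriv (bandCopulaPos b) v t = clampedRamp b (bandMax b v) t := by
  rw [fstDeriv_eq_deriv _ hv ht]
  exact (continuous_clampedRamp b _).deriv_integral _ 0 t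

end bandMax

section Integrals

lemma integral_eq_integral_add_reflect_add_integral {F : ℝ → ℝ} {τ : ℝ}
    (hF : IntervalIntegrable F volume 0 1) (hτ : τ ∈ I) :
    ∫ v in (0 : ℝ)..1, F v = (∫ v in (0 : ℝ)..τ, (F v + F (1 - v))) + ∫ v in τ..1 - τ, F v := by
  have h_sub : ∀ a ∈ I, ∀ b ∈ I, IntervalIntegrable F volume a b := fun a ha b hb =>
    hF.mono_set (uIcc_subset_uIcc (by simpa using ha) (by simpa using hb))
  have h0 := unitInterval.zero_mem
  have h1 := unitInterval.one_mem
  have hτ' : 1 - τ ∈ I := Icc.one_sub_mem hτ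
  have h_reflect : IntervalIntegrable (fun v => F (1 - v)) volume 0 τ := by
    simpa using (h_sub 1 h1 (1 - τ) hτ').comp_sub_left 1
  rw [intervalIntegral.integral_add (h_sub 0 h0 τ hτ) h_reflect,
    intervalIntegral.integral_comp_sub_left F 1, sub_zero,
    ← intervalIntegral.integral_add_adjacent_intervals (h_sub 0 h0 τ hτ) (h_sub τ hτ 1 h1),
    ← intervalIntegral.integral_add_adjacent_intervals (h_sub τ hτ (1 - τ) hτ')
      (h_sub (1 - τ) hτ' 1 h1)]
  ring

lemma integral_sqrt_mul_pow {c w : ℝ} (hc : 0 ≤ c) (hw : 0 ≤ w) (n : ℕ) :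
    ∫ v in (0 : ℝ)..w, √(c * v) ^ n = 2 / (n + 2) * w * √(c * w) ^ n := by
  have h_rpow : ∀ x : ℝ, 0 ≤ x → √x ^ n = x ^ (n / 2 : ℝ) := fun x hx => by
    rw [Real.sqrt_eq_rpow, ← Real.rpow_natCast, ← Real.rpow_mul hx, one_div_mul_eq_div]
  have h_exp_pos : 0 < (n / 2 + 1 : ℝ) := by positivity
  have h_exp := h_exp_pos.ne'
  have h_scale : EqOn (fun v => √(c * v) ^ n) (fun v => √c ^ n * v ^ (n / 2 : ℝ)) (uIcc 0 w) := by
    intro v hv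
    rw [uIcc_of_le hw] at hv
    simp only [Real.sqrt_mul hc, mul_pow, h_rpow v hv.1]
  rw [intervalIntegral.integral_congr h_scale, intervalIntegral.integral_const_mul,
    integral_rpow (.inl (by linarith [h_exp_pos])),
    Real.zero_rpow h_exp, Real.rpow_add_one' hw h_exp, Real.sqrt_mul hc, mul_pow, h_rpow w hw]
  field_simp
  ring

lemma integral_quadratic (p q r a b : ℝ) :
    ∫ v in a..b, (p + q * v + r * v ^ 2) =
      p * (b - a) + q * ((b ^ 2 - a ^ 2) / 2) + r * ((b ^ 3 - a ^ 3) / 3) := by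
  rw [intervalIntegral.integral_add (Continuous.intervalIntegrable (by fun_prop) _ _)
      (Continuous.intervalIntegrable (by fun_prop) _ _),
    intervalIntegral.integral_add (Continuous.intervalIntegrable (by fun_prop) _ _)
      (Continuous.intervalIntegrable (by fun_prop) _ _), intervalIntegral.integral_const_mul,
    intervalIntegral.integral_const_mul, integral_id, integral_pow]
  norm_num
  ring

end Integrals

section bandCopulaPos

variable {b v : ℝ}

lemma integral_of_eq_sqrt_of_eq_quadratic {F : ℝ → ℝ} {τ α β γ p q r : ℝ} (hb : 0 ≤ b)
    (hF : IntervalIntegrable F volume 0 1) (h0 : 0 ≤ τ) (h1 : τ ≤ 1 / 2)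
    (h_ends : ∀ v ∈ Ioo 0 τ, F v + F (1 - v) = α + β * v + γ * √(2 * v / b) ^ 3)
    (h_mid : ∀ v ∈ Ioo τ (1 - τ), F v = p + q * v + r * v ^ 2) :
    ∫ v in (0 : ℝ)..1, F v = α * τ + β * (τ ^ 2 / 2) + γ * (2 / 5 * τ * √(2 * τ / b) ^ 3)
      + (p + q / 2) * (1 - 2 * τ) + r * (((1 - τ) ^ 3 - τ ^ 3) / 3) := by
  have h_assoc : ∀ v, 2 * v / b = 2 / b * v := fun v => by ring
  have h_sqrt : ∫ v in (0 : ℝ)..τ, √(2 * v / b) ^ 3 = 2 / 5 * τ * √(2 * τ / b) ^ 3 := by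
    simp only [h_assoc]
    rw [integral_sqrt_mul_pow (by positivity) h0]
    norm_num
  rw [integral_eq_integral_add_reflect_add_integral hF ⟨h0, by linarith⟩,
    intervalIntegral.integral_congr_Ioo_of_le h0 h_ends,
    intervalIntegral.integral_congr_Ioo_of_le (by linarith) h_mid, integral_quadratic,
    intervalIntegral.integral_add (Continuous.intervalIntegrable (by fun_prop) _ _)
      (Continuous.intervalIntegrable (by fun_prop) _ _), intervalIntegral.integral_const_mul,
    h_sqrt, intervalIntegral.integral_add (Continuous.intervalIntegrable (by fun_prop) _ _)
      (Continuous.intervalIntegrable (by fun_prop) _ _), intervalIntegral.integral_const_mul,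
    integral_id, intervalIntegral.integral_const, smul_eq_mul]
  ring

lemma integral_fstDeriv_bandCopulaPos_sq (b : ℝ) (hv : v ∈ I) :
    ∫ t in (0 : ℝ)..1, fstDeriv (bandCopulaPos b) v t ^ 2 =
      ∫ t in (0 : ℝ)..1, clampedRamp b (bandMax b v) t ^ 2 :=
  intervalIntegral.integral_congr_Ioo_of_le zero_le_one fun t ht => by
    simp only [fstDeriv_bandCopulaPos b hv ht]

lemma integral_bandCopulaPos (hb : 0 < b) (hv : v ∈ I) :
    ∫ u in (0 : ℝ)..1, bandCopulaPos b u v =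
      ∫ t in (0 : ℝ)..1, (1 - t) * clampedRamp b (bandMax b v) t := by
  rw [← (isCopula_bandCopulaPos hb).integral_one_sub_mul_fstDeriv hv]
  exact intervalIntegral.integral_congr_Ioo_of_le zero_le_one fun t ht => by
    simp only [fstDeriv_bandCopulaPos b hv ht]

lemma chatterjeeXi_bandCopulaPos {p q r : ℝ} (hb : 0 < b)
    (h_mid : ∀ v ∈ Ioo (bandSplit b) (1 - bandSplit b),
      ∫ t in (0 : ℝ)..1, clampedRamp b (bandMax b v) t ^ 2 = p + q * v + r * v ^ 2) :
    chatterjeeXi (bandCopulaPos b) = 6 * (bandSplit b - bandSplit b ^ 2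
      + 4 / 15 * b ^ 2 * bandSplit b * √(2 * bandSplit b / b) ^ 3
      + (p + q / 2) * (1 - 2 * bandSplit b)
      + r * (((1 - bandSplit b) ^ 3 - bandSplit b ^ 3) / 3)) - 2 := by
  have h_half := bandSplit_le_half hb
  have h_pos := bandSplit_pos hb
  rw [chatterjeeXi_eq, integral_of_eq_sqrt_of_eq_quadratic (τ := bandSplit b) (α := 1) (β := -2)
    (γ := 2 * b ^ 2 / 3) (p := p) (q := q) (r := r) hb.le
    ((isCopula_bandCopulaPos hb).intervalIntegrable_integral_fstDeriv_sq 0 1 0 1) h_pos.le h_half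
    (fun v hv => ?_) fun v hv => ?_]
  · ring
  · have hv' : v ∈ I := ⟨hv.1.le, by linarith [hv.2]⟩
    rw [integral_fstDeriv_bandCopulaPos_sq b hv',
      integral_fstDeriv_bandCopulaPos_sq b (Icc.one_sub_mem hv'),
      (moments_low hb hv.1.le hv.2.le).2.1,
      (moments_high hb (by linarith [hv.1]) (by linarith [hv.2])).2.1, sub_sub_cancel]
    ring
  · rw [integral_fstDeriv_bandCopulaPos_sq b ⟨by linarith [hv.1], by linarith [hv.2]⟩, h_mid v hv]

lemma spearmanRho_bandCopulaPos {p q r : ℝ} (hb : 0 < b)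
    (h_mid : ∀ v ∈ Ioo (bandSplit b) (1 - bandSplit b),
      ∫ t in (0 : ℝ)..1, (1 - t) * clampedRamp b (bandMax b v) t = p + q * v + r * v ^ 2) :
    spearmanRho (bandCopulaPos b) = 12 * (bandSplit b / 2 + bandSplit b ^ 2 / 2
      - 2 / 15 * b * bandSplit b * √(2 * bandSplit b / b) ^ 3
      + (p + q / 2) * (1 - 2 * bandSplit b)
      + r * (((1 - bandSplit b) ^ 3 - bandSplit b ^ 3) / 3)) - 3 := by
  have h_half := bandSplit_le_half hb
  have h_pos := bandSplit_pos hb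
  have hC := isCopula_bandCopulaPos hb
  rw [hC.spearmanRho_eq, integral_of_eq_sqrt_of_eq_quadratic (τ := bandSplit b) (α := 1 / 2)
    (β := 1) (γ := -(b / 3)) (p := p) (q := q) (r := r) hb.le hC.intervalIntegrable_integral
    h_pos.le h_half (fun v hv => ?_) fun v hv => ?_]
  · ring
  · have hv' : v ∈ I := ⟨hv.1.le, by linarith [hv.2]⟩
    rw [integral_bandCopulaPos hb hv',
      integral_bandCopulaPos hb (Icc.one_sub_mem hv'),
      (moments_low hb hv.1.le hv.2.le).2.2,
      (moments_high hb (by linarith [hv.1]) (by linarith [hv.2])).2.2, sub_sub_cancel]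
    ring
  · rw [integral_bandCopulaPos hb ⟨by linarith [hv.1], by linarith [hv.2]⟩, h_mid v hv]

lemma sqrt_bandSplit_of_one_le (hb : 1 ≤ b) : √(2 * bandSplit b / b) = 1 / b := by
  rw [bandSplit_of_one_le hb, Real.sqrt_eq_iff_mul_self_eq_of_pos (by positivity)]
  field_simp

lemma sqrt_bandSplit_of_le_one (hb : 0 < b) (hb1 : b ≤ 1) : √(2 * bandSplit b / b) = 1 := by
  rw [bandSplit_of_le_one hb hb1, mul_div_cancel₀ b two_ne_zero, div_self hb.ne', Real.sqrt_one]

lemma chatterjeeXi_bandCopulaPos_of_one_le (hb : 1 ≤ b) :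
    chatterjeeXi (bandCopulaPos b) = 1 - 1 / b + 3 / (10 * b ^ 2) := by
  have hb0 : 0 < b := by linarith
  rw [chatterjeeXi_bandCopulaPos (p := -(1 / (6 * b))) (q := 1) (r := 0) hb0 fun v hv => ?_,
    sqrt_bandSplit_of_one_le hb, bandSplit_of_one_le hb]
  · field_simp
    ring
  · rw [bandSplit_of_one_le hb] at hv
    rw [(moments_middle_of_one_le hb hv.1 hv.2.le).2.1]
    ring

lemma spearmanRho_bandCopulaPos_of_one_le (hb : 1 ≤ b) :
    spearmanRho (bandCopulaPos b) = 1 - 1 / (2 * b ^ 2) + 1 / (5 * b ^ 3) := by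
  have hb0 : 0 < b := by linarith
  rw [spearmanRho_bandCopulaPos (p := -(1 / (24 * b ^ 2))) (q := 1) (r := -1 / 2) hb0
      fun v hv => ?_, sqrt_bandSplit_of_one_le hb, bandSplit_of_one_le hb]
  · field_simp
    ring
  · rw [bandSplit_of_one_le hb] at hv
    rw [(moments_middle_of_one_le hb hv.1 hv.2.le).2.2]
    ring

lemma chatterjeeXi_bandCopulaPos_of_le_one (hb : 0 < b) (hb1 : b ≤ 1) :
    chatterjeeXi (bandCopulaPos b) = b ^ 2 / 2 - b ^ 3 / 5 := by
  rw [chatterjeeXi_bandCopulaPos (p := b ^ 2 / 12) (q := 0) (r := 1) hb fun v hv => ?_,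
    sqrt_bandSplit_of_le_one hb hb1, bandSplit_of_le_one hb hb1]
  · ring
  · rw [bandSplit_of_le_one hb hb1] at hv
    rw [(moments_middle_of_le_one hb hb1 hv.1 hv.2.le).2.1]
    ring

lemma spearmanRho_bandCopulaPos_of_le_one (hb : 0 < b) (hb1 : b ≤ 1) :
    spearmanRho (bandCopulaPos b) = b - 3 * b ^ 2 / 10 := by
  rw [spearmanRho_bandCopulaPos (p := b / 12) (q := 1 / 2) (r := 0) hb fun v hv => ?_,
    sqrt_bandSplit_of_le_one hb hb1, bandSplit_of_le_one hb hb1]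
  · ring
  · rw [bandSplit_of_le_one hb hb1] at hv
    rw [(moments_middle_of_le_one hb hb1 hv.1 hv.2.le).2.2]
    ring

end bandCopulaPos

namespace IsCopula

variable {C : ℝ → ℝ → ℝ} {b : ℝ}

lemma integral_fstDeriv_bandCopulaPos_sq_add_le (hC : IsCopula C) (hb : 0 < b) {v : ℝ}
    (hv : v ∈ I) :
    (∫ t in (0 : ℝ)..1, fstDeriv (bandCopulaPos b) v t ^ 2)
      + 2 * b * ((∫ u in (0 : ℝ)..1, C u v) - ∫ u in (0 : ℝ)..1, bandCopulaPos b u v)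
      + ∫ t in (0 : ℝ)..1, (fstDeriv C v t - fstDeriv (bandCopulaPos b) v t) ^ 2 ≤
      ∫ t in (0 : ℝ)..1, fstDeriv C v t ^ 2 := by
  have h_mean : ∫ t in (0 : ℝ)..1, fstDeriv C v t =
      ∫ t in (0 : ℝ)..1, clampedRamp b (bandMax b v) t := by
    rw [hC.integral_fstDeriv unitInterval.one_mem hv, hC.marginal_left v hv,
      integral_clampedRamp_bandMax hb hv]
  have h_dist : ∫ t in (0 : ℝ)..1, (fstDeriv C v t - fstDeriv (bandCopulaPos b) v t) ^ 2 =
      ∫ t in (0 : ℝ)..1, (fstDeriv C v t - clampedRamp b (bandMax b v) t) ^ 2 :=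
    intervalIntegral.integral_congr_Ioo_of_le zero_le_one fun t ht => by
      simp only [fstDeriv_bandCopulaPos b hv ht]
  rw [integral_fstDeriv_bandCopulaPos_sq b hv, integral_bandCopulaPos hb hv, h_dist,
    ← hC.integral_one_sub_mul_fstDeriv hv]
  exact integral_clampedRamp_sq_add_le b _ (hC.measurable_fstDeriv_right v) (hC.fstDeriv_mem v)
    h_mean

/-- Integrated over `v`, the sectionwise minimality says that `C_b` maximizes `b ρ - ξ`, and does
so with a quadratic gap. -/
theorem mul_spearmanRho_sub_add_fstDerivSqDist_le (hC : IsCopula C) (hb : 0 < b) :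
    b * (spearmanRho C - spearmanRho (bandCopulaPos b)) + 6 * fstDerivSqDist C (bandCopulaPos b) ≤
      chatterjeeXi C - chatterjeeXi (bandCopulaPos b) := by
  have hB := isCopula_bandCopulaPos hb
  have h_sq := hB.intervalIntegrable_integral_fstDeriv_sq 0 1 0 1
  have h_lin := (hC.intervalIntegrable_integral.sub hB.intervalIntegrable_integral).const_mul
    (2 * b)
  have h_dist := hC.intervalIntegrable_integral_fstDeriv_sub_sq hB 0 1 0 1
  have h_le := intervalIntegral.integral_mono_on zero_le_one ((h_sq.add h_lin).add h_dist)
    (hC.intervalIntegrable_integral_fstDeriv_sq 0 1 0 1)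
    fun v hv => hC.integral_fstDeriv_bandCopulaPos_sq_add_le hb hv
  rw [intervalIntegral.integral_add (h_sq.add h_lin) h_dist,
    intervalIntegral.integral_add h_sq h_lin, intervalIntegral.integral_const_mul,
    intervalIntegral.integral_sub hC.intervalIntegrable_integral hB.intervalIntegrable_integral]
    at h_le
  rw [hC.spearmanRho_eq, hB.spearmanRho_eq, chatterjeeXi_eq, chatterjeeXi_eq, fstDerivSqDist]
  linarith

theorem eq_bandCopulaPos (hC : IsCopula C) (hb : 0 < b)
    (h_xi : chatterjeeXi C = chatterjeeXi (bandCopulaPos b))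
    (h_rho : spearmanRho C = spearmanRho (bandCopulaPos b)) {u v : ℝ} (hu : u ∈ I) (hv : v ∈ I) :
    C u v = bandCopulaPos b u v := by
  have h_le := hC.mul_spearmanRho_sub_add_fstDerivSqDist_le hb
  rw [h_xi, h_rho, sub_self, sub_self, mul_zero, zero_add] at h_le
  have h_zero : fstDerivSqDist C (bandCopulaPos b) = 0 :=
    le_antisymm (by linarith) (fstDerivSqDist_nonneg _ _)
  exact hC.eq_of_fstDerivSqDist_eq_zero (isCopula_bandCopulaPos hb) h_zero hu hv

theorem chatterjeeXi_nonneg (hC : IsCopula C) : 0 ≤ chatterjeeXi C := by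
  have h_section : ∀ v ∈ I, v ^ 2 ≤ ∫ t in (0 : ℝ)..1, fstDeriv C v t ^ 2 := fun v hv => by
    have h_var : 0 ≤ ∫ t in (0 : ℝ)..1, (fstDeriv C v t - v) ^ 2 :=
      intervalIntegral.integral_nonneg zero_le_one fun t _ => sq_nonneg _
    rw [integral_sub_sq (hC.intervalIntegrable_fstDeriv_sq v 0 1)
      ((hC.intervalIntegrable_fstDeriv v 0 1).const_mul v) intervalIntegrable_const,
      intervalIntegral.integral_const_mul, hC.integral_fstDeriv unitInterval.one_mem hv,
      hC.marginal_left v hv, intervalIntegral.integral_const, sub_zero, one_smul] at h_var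
    linarith
  have h_le := intervalIntegral.integral_mono_on zero_le_one
    ((continuous_pow 2).intervalIntegrable 0 1)
    (hC.intervalIntegrable_integral_fstDeriv_sq 0 1 0 1) h_section
  rw [integral_pow] at h_le
  rw [chatterjeeXi_eq]
  norm_num at h_le
  linarith

theorem chatterjeeXi_le_one (hC : IsCopula C) : chatterjeeXi C ≤ 1 := by
  have h_section : ∀ v ∈ I, ∫ t in (0 : ℝ)..1, fstDeriv C v t ^ 2 ≤ v := fun v hv => by
    have h_le := intervalIntegral.integral_mono zero_le_one
      (hC.intervalIntegrable_fstDeriv_sq v 0 1) (hC.intervalIntegrable_fstDeriv v 0 1)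
      fun t => pow_le_of_le_one (hC.fstDeriv_mem v t).1 (hC.fstDeriv_mem v t).2 two_ne_zero
    rwa [hC.integral_fstDeriv unitInterval.one_mem hv, hC.marginal_left v hv] at h_le
  have h_le := intervalIntegral.integral_mono_on zero_le_one
    (hC.intervalIntegrable_integral_fstDeriv_sq 0 1 0 1) (continuous_id.intervalIntegrable 0 1)
    h_section
  simp only [id, integral_id] at h_le
  rw [chatterjeeXi_eq]
  linarith

end IsCopula

/-- The reflection of a copula in the first coordinate. -/
def reflection (C : ℝ → ℝ → ℝ) (u v : ℝ) : ℝ := v - C (1 - u) v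

/-- The copula obtained from `C` by reversing the first coordinate on `[θ, 1]`. It connects the
reflection (`θ = 0`) to `C` itself (`θ = 1`). Evaluating the extension of `C` makes it jointly
continuous in `θ` and the coordinates. -/
def partialReflection (C : ℝ → ℝ → ℝ) (θ u v : ℝ) : ℝ :=
  unitExtension C (min u θ) v + v - unitExtension C (1 + θ - max u θ) v

section reflection

variable {C : ℝ → ℝ → ℝ} {θ u v t : ℝ}

lemma min_mem_unitInterval (hu : u ∈ I) (hθ : θ ∈ I) : min u θ ∈ I :=
  ⟨le_min hu.1 hθ.1, min_le_of_left_le hu.2⟩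

lemma one_add_sub_max_mem_unitInterval (hu : u ∈ I) (hθ : θ ∈ I) : 1 + θ - max u θ ∈ I :=
  ⟨by linarith [max_le hu.2 hθ.2, hθ.1], by linarith [le_max_right u θ]⟩

lemma partialReflection_of_mem (C : ℝ → ℝ → ℝ) (hθ : θ ∈ I) (hu : u ∈ I) (hv : v ∈ I) :
    partialReflection C θ u v = C (min u θ) v + v - C (1 + θ - max u θ) v := by
  rw [partialReflection, unitExtension_of_mem C (min_mem_unitInterval hu hθ) hv,
    unitExtension_of_mem C (one_add_sub_max_mem_unitInterval hu hθ) hv]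

lemma partialReflection_of_ge (C : ℝ → ℝ → ℝ) (hθ : θ ∈ I) (hu : u ∈ I) (hv : v ∈ I)
    (h : θ ≤ u) : partialReflection C θ u v = C θ v + v - C (1 + θ - u) v := by
  rw [partialReflection_of_mem C hθ hu hv, min_eq_right h, max_eq_left h]

namespace IsCopula

lemma partialReflection_of_le (hC : IsCopula C) (hθ : θ ∈ I) (hu : u ∈ I) (hv : v ∈ I)
    (h : u ≤ θ) : partialReflection C θ u v = C u v := by
  rw [partialReflection_of_mem C hθ hu hv, min_eq_left h, max_eq_right h, add_sub_cancel_right,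
    hC.marginal_left v hv, add_sub_cancel_right]

lemma partialReflection_zero (hC : IsCopula C) (hu : u ∈ I) (hv : v ∈ I) :
    partialReflection C 0 u v = reflection C u v := by
  rw [partialReflection_of_ge C unitInterval.zero_mem hu hv hu.1, hC.grounded_left v hv, zero_add,
    add_zero, reflection]

lemma isCopula_partialReflection (hC : IsCopula C) (hθ : θ ∈ I) :
    IsCopula (partialReflection C θ) := by
  have h_min : ∀ u ∈ I, min u θ ∈ I := fun u hu => min_mem_unitInterval hu hθ
  have h_max : ∀ u ∈ I, 1 + θ - max u θ ∈ I := fun u hu => one_add_sub_max_mem_unitInterval hu hθ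
  refine of_two_increasing (fun v hv => ?_) (fun u hu => ?_) (fun v hv => ?_)
    (fun u hu => ?_) fun u hu u' hu' v hv v' hv' h_u h_v => ?_
  · rw [hC.partialReflection_of_le hθ unitInterval.zero_mem hv hθ.1, hC.grounded_left v hv]
  · rw [partialReflection_of_mem C hθ hu unitInterval.zero_mem, hC.grounded_right _ (h_min u hu),
      hC.grounded_right _ (h_max u hu), add_zero, sub_zero]
  · rw [partialReflection_of_ge C hθ unitInterval.one_mem hv hθ.2, add_sub_cancel_left,
      add_sub_cancel_left]
  · rw [partialReflection_of_mem C hθ hu unitInterval.one_mem, hC.marginal_right _ (h_min u hu),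
      hC.marginal_right _ (h_max u hu)]
    linarith [min_add_max u θ]
  · have h_low := hC.two_increasing _ (h_min u hu) _ (h_min u' hu') v hv v' hv'
      (min_le_min_right _ h_u) h_v
    have h_high := hC.two_increasing _ (h_max u' hu') _ (h_max u hu) v hv v' hv'
      (by linarith [max_le_max_right θ h_u]) h_v
    rw [partialReflection_of_mem C hθ hu hv, partialReflection_of_mem C hθ hu' hv',
      partialReflection_of_mem C hθ hu hv', partialReflection_of_mem C hθ hu' hv]
    linarith

lemma isCopula_reflection (hC : IsCopula C) : IsCopula (reflection C) := by
  have h_eq : ∀ u ∈ I, ∀ v ∈ I, partialReflection C 0 u v = reflection C u v :=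
    fun u hu v hv => hC.partialReflection_zero hu hv
  exact (hC.isCopula_partialReflection unitInterval.zero_mem).congr h_eq

lemma fstDeriv_partialReflection_of_lt (hC : IsCopula C) (hθ : θ ∈ I) (hv : v ∈ I)
    (ht : t ∈ Ioo 0 θ) : fstDeriv (partialReflection C θ) v t = fstDeriv C v t := by
  have h_sub : Ioo 0 θ ⊆ Ioo 0 1 := Ioo_subset_Ioo_right hθ.2
  rw [fstDeriv_eq_deriv _ hv (h_sub ht), fstDeriv_eq_deriv _ hv (h_sub ht)]
  refine Filter.EventuallyEq.deriv_eq ?_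
  filter_upwards [isOpen_Ioo.mem_nhds ht] with s hs
  exact hC.partialReflection_of_le hθ (Ioo_subset_Icc_self (h_sub hs)) hv hs.2.le

end IsCopula

lemma fstDeriv_partialReflection_of_gt (C : ℝ → ℝ → ℝ) (hθ : θ ∈ I) (hv : v ∈ I)
    (ht : t ∈ Ioo θ 1) :
    fstDeriv (partialReflection C θ) v t = fstDeriv C v (1 + θ - t) := by
  have h_sub : Ioo θ 1 ⊆ Ioo 0 1 := Ioo_subset_Ioo_left hθ.1
  have h_eq : (fun s => partialReflection C θ s v) =ᶠ[𝓝 t]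
      fun s => C θ v + v - (fun x => C x v) (1 + θ - s) := by
    filter_upwards [isOpen_Ioo.mem_nhds ht] with s hs
    exact partialReflection_of_ge C hθ (Ioo_subset_Icc_self (h_sub hs)) hv hs.1.le
  rw [fstDeriv_eq_deriv _ hv (h_sub ht),
    fstDeriv_eq_deriv _ hv ⟨by linarith [ht.2, hθ.1], by linarith [ht.1]⟩, h_eq.deriv_eq,
    deriv_const_sub, deriv_comp_const_sub (fun x => C x v), neg_neg]

namespace IsCopula

lemma integral_fstDeriv_partialReflection_sq (hC : IsCopula C) (hθ : θ ∈ I) (hv : v ∈ I) :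
    ∫ t in (0 : ℝ)..1, fstDeriv (partialReflection C θ) v t ^ 2 =
      ∫ t in (0 : ℝ)..1, fstDeriv C v t ^ 2 := by
  have h_int := (hC.isCopula_partialReflection hθ).intervalIntegrable_fstDeriv_sq v
  have h_low : ∫ t in (0 : ℝ)..θ, fstDeriv (partialReflection C θ) v t ^ 2 =
      ∫ t in (0 : ℝ)..θ, fstDeriv C v t ^ 2 :=
    intervalIntegral.integral_congr_Ioo_of_le hθ.1 fun t ht => by
      simp only [hC.fstDeriv_partialReflection_of_lt hθ hv ht]
  have h_high : ∫ t in θ..1, fstDeriv (partialReflection C θ) v t ^ 2 =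
      ∫ t in θ..1, fstDeriv C v (1 + θ - t) ^ 2 :=
    intervalIntegral.integral_congr_Ioo_of_le hθ.2 fun t ht => by
      simp only [fstDeriv_partialReflection_of_gt C hθ hv ht]
  rw [← intervalIntegral.integral_add_adjacent_intervals (h_int 0 θ) (h_int θ 1), h_low, h_high,
    intervalIntegral.integral_comp_sub_left (fun t => fstDeriv C v t ^ 2) (1 + θ),
    add_sub_cancel_left, add_sub_cancel_right, intervalIntegral.integral_add_adjacent_intervals
      (hC.intervalIntegrable_fstDeriv_sq v 0 θ) (hC.intervalIntegrable_fstDeriv_sq v θ 1)]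

lemma chatterjeeXi_partialReflection (hC : IsCopula C) (hθ : θ ∈ I) :
    chatterjeeXi (partialReflection C θ) = chatterjeeXi C := by
  rw [chatterjeeXi_eq, chatterjeeXi_eq]
  congr 2
  refine intervalIntegral.integral_congr fun v hv => ?_
  rw [uIcc_of_le zero_le_one] at hv
  exact hC.integral_fstDeriv_partialReflection_sq hθ hv

lemma chatterjeeXi_reflection (hC : IsCopula C) : chatterjeeXi (reflection C) = chatterjeeXi C := by
  rw [← chatterjeeXi_congr fun u hu v hv => hC.partialReflection_zero hu hv,
    hC.chatterjeeXi_partialReflection unitInterval.zero_mem]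

lemma integral_reflection (hC : IsCopula C) (hv : v ∈ I) :
    ∫ u in (0 : ℝ)..1, reflection C u v = v - ∫ u in (0 : ℝ)..1, C u v := by
  have h_int : IntervalIntegrable (fun u => C u v) volume 0 1 :=
    (hC.continuousOn_left hv).intervalIntegrable_of_Icc zero_le_one
  have h_subst := intervalIntegral.integral_comp_sub_left (a := 0) (b := 1) (fun u => v - C u v) 1
  rw [sub_self, sub_zero, intervalIntegral.integral_sub intervalIntegrable_const h_int,
    intervalIntegral.integral_const, sub_zero, one_smul] at h_subst
  exact h_subst

lemma spearmanRho_reflection (hC : IsCopula C) : spearmanRho (reflection C) = -spearmanRho C := by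
  have h_congr : ∫ v in (0 : ℝ)..1, ∫ u in (0 : ℝ)..1, reflection C u v =
      ∫ v in (0 : ℝ)..1, (v - ∫ u in (0 : ℝ)..1, C u v) :=
    intervalIntegral.integral_congr fun v hv => by
      rw [uIcc_of_le zero_le_one] at hv
      exact hC.integral_reflection hv
  rw [hC.isCopula_reflection.spearmanRho_eq, hC.spearmanRho_eq, h_congr,
    intervalIntegral.integral_sub (continuous_id'.intervalIntegrable 0 1)
      hC.intervalIntegrable_integral, integral_id]
  ring

lemma continuous_spearmanRho_partialReflection (hC : IsCopula C) :
    Continuous fun θ => spearmanRho (partialReflection C θ) := by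
  unfold spearmanRho
  refine (continuous_const.mul ?_).sub continuous_const
  refine continuous_parametric_integral_of_continuous (f := fun θ (p : ℝ × ℝ) =>
    partialReflection C θ p.1 p.2) ?_ (isCompact_Icc.prod isCompact_Icc)
  have h_low : Continuous fun q : ℝ × ℝ × ℝ => unitExtension C (min q.2.1 q.1) q.2.2 :=
    hC.continuous_unitExtension.comp (f := fun q : ℝ × ℝ × ℝ => (min q.2.1 q.1, q.2.2))
      (by fun_prop)
  have h_high : Continuous fun q : ℝ × ℝ × ℝ => unitExtension C (1 + q.1 - max q.2.1 q.1) q.2.2 :=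
    hC.continuous_unitExtension.comp (f := fun q : ℝ × ℝ × ℝ => (1 + q.1 - max q.2.1 q.1, q.2.2))
      (by fun_prop)
  exact (h_low.add (by fun_prop)).sub h_high

theorem exists_chatterjeeXi_eq_spearmanRho_eq (hC : IsCopula C) {y : ℝ}
    (hy : |y| ≤ spearmanRho C) :
    ∃ D, IsCopula D ∧ chatterjeeXi D = chatterjeeXi C ∧ spearmanRho D = y := by
  have h_zero : spearmanRho (partialReflection C 0) = -spearmanRho C := by
    rw [spearmanRho_congr fun u hu v hv => hC.partialReflection_zero hu hv,
      hC.spearmanRho_reflection]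
  have h_one : spearmanRho (partialReflection C 1) = spearmanRho C :=
    spearmanRho_congr fun u hu v hv =>
      hC.partialReflection_of_le unitInterval.one_mem hu hv hu.2
  have h_mem : y ∈ Icc (spearmanRho (partialReflection C 0))
      (spearmanRho (partialReflection C 1)) := by
    rw [h_zero, h_one]
    exact abs_le.1 hy
  obtain ⟨θ, hθ, h_rho⟩ := intermediate_value_Icc (zero_le_one' ℝ)
    hC.continuous_spearmanRho_partialReflection.continuousOn h_mem
  exact ⟨_, hC.isCopula_partialReflection hθ, hC.chatterjeeXi_partialReflection hθ, h_rho⟩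

end IsCopula

end reflection

/-- The line of slope `1 / b` through `(ξ(C_b), ρ(C_b))`. The maximality of `C_b` says that it
supports the region from above. -/
def supportLine (b x : ℝ) : ℝ :=
  spearmanRho (bandCopulaPos b) + (x - chatterjeeXi (bandCopulaPos b)) / b

section supportLine

variable {b x y : ℝ}

lemma supportLine_chatterjeeXi (b : ℝ) :
    supportLine b (chatterjeeXi (bandCopulaPos b)) = spearmanRho (bandCopulaPos b) := by
  rw [supportLine, sub_self, zero_div, add_zero]

lemma supportLine_combo (b x y : ℝ) {p q : ℝ} (hpq : p + q = 1) :
    supportLine b (p * x + q * y) = p * supportLine b x + q * supportLine b y := by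
  obtain rfl : q = 1 - p := by linarith
  unfold supportLine
  ring

lemma IsCopula.spearmanRho_le_supportLine {C : ℝ → ℝ → ℝ} (hC : IsCopula C) (hb : 0 < b) :
    spearmanRho C ≤ supportLine b (chatterjeeXi C) := by
  have h_le := hC.mul_spearmanRho_sub_add_fstDerivSqDist_le hb
  have h_dist := fstDerivSqDist_nonneg C (bandCopulaPos b)
  rw [supportLine, ← sub_le_iff_le_add', le_div_iff₀' hb]
  linarith

lemma IsCopula.abs_spearmanRho_le_supportLine {C : ℝ → ℝ → ℝ} (hC : IsCopula C) (hb : 0 < b) :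
    |spearmanRho C| ≤ supportLine b (chatterjeeXi C) := by
  have h_refl := hC.isCopula_reflection.spearmanRho_le_supportLine hb
  rw [hC.spearmanRho_reflection, hC.chatterjeeXi_reflection] at h_refl
  exact abs_le'.2 ⟨hC.spearmanRho_le_supportLine hb, h_refl⟩

lemma supportLine_le_of_le_one (hb : 0 < b) (hb1 : b ≤ 1) (x : ℝ) :
    supportLine b x ≤ b / 2 + x / b := by
  have h_eq : supportLine b x = b / 2 - b ^ 2 / 10 + x / b := by
    rw [supportLine, chatterjeeXi_bandCopulaPos_of_le_one hb hb1,
      spearmanRho_bandCopulaPos_of_le_one hb hb1]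
    field_simp
    ring
  rw [h_eq]
  gcongr
  linarith [sq_nonneg b]

lemma supportLine_le_of_one_le (hb : 1 ≤ b) (x : ℝ) :
    supportLine b x ≤ 1 + (x - 1 + 1 / b) / b := by
  have : 0 < b := one_pos.trans_le hb
  have h_eq : supportLine b x =
      1 + (x - 1 + 1 / b) / b - (1 / (2 * b ^ 2) + 1 / (10 * b ^ 3)) := by
    rw [supportLine, chatterjeeXi_bandCopulaPos_of_one_le hb,
      spearmanRho_bandCopulaPos_of_one_le hb]
    field_simp
    ring
  rw [h_eq]
  exact sub_le_self _ (by positivity)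

lemma nonpos_of_forall_le_supportLine (h : ∀ b > 0, y ≤ supportLine b 0) : y ≤ 0 := by
  by_contra! hy
  have hb : 0 < min y 1 := lt_min hy one_pos
  have h_le := (h _ hb).trans (supportLine_le_of_le_one hb (min_le_right y 1) 0)
  rw [zero_div, add_zero] at h_le
  linarith [min_le_left y 1]

lemma le_of_forall_one_le_le_add_one_div {a c : ℝ} (h : ∀ b ≥ 1, a ≤ c + 1 / b) : a ≤ c := by
  refine le_of_forall_pos_le_add fun ε hε => ?_
  obtain ⟨n, hn⟩ := exists_nat_one_div_lt hε
  linarith [h (n + 1) (le_add_of_nonneg_left n.cast_nonneg)]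

lemma le_one_of_forall_le_supportLine (h : ∀ b > 0, y ≤ supportLine b 1) : y ≤ 1 := by
  refine le_of_forall_one_le_le_add_one_div fun b hb => ?_
  have hb0 : 0 < b := one_pos.trans_le hb
  refine (h b hb0).trans ((supportLine_le_of_one_le hb 1).trans ?_)
  rw [sub_self, zero_add]
  gcongr
  exact div_le_self (by positivity) hb

/-- The excess over `1` of the line at `x = 1` is `O(1 / b ^ 2)`, smaller than its slope `1 / b`. -/
lemma one_le_of_forall_one_le_supportLine (h : ∀ b > 0, 1 ≤ supportLine b x) : 1 ≤ x := by
  refine le_of_forall_one_le_le_add_one_div fun b hb => ?_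
  have hb0 : 0 < b := one_pos.trans_le hb
  have h_le := (h b hb0).trans (supportLine_le_of_one_le hb x)
  have h_num := nonneg_of_mul_nonneg_left ((le_add_iff_nonneg_right _).1 h_le) (inv_pos.2 hb0)
  linarith

end supportLine

section bParam

variable {x : ℝ}

lemma cos_one_third_mul_arccos {z : ℝ} (h1 : -1 ≤ z) (h2 : z ≤ 1) :
    4 * Real.cos (1 / 3 * Real.arccos z) ^ 3 - 3 * Real.cos (1 / 3 * Real.arccos z) = z := by
  rw [← Real.cos_three_mul, ← mul_assoc, mul_one_div_cancel three_ne_zero, one_mul,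
    Real.cos_arccos h1 h2]

lemma half_le_cos_one_third_mul_arccos (z : ℝ) :
    1 / 2 ≤ Real.cos (1 / 3 * Real.arccos z) := by
  rw [← Real.cos_pi_div_three]
  exact Real.cos_le_cos_of_nonneg_of_le_pi (by linarith [Real.arccos_nonneg z])
    (by linarith [Real.pi_pos]) (by linarith [Real.arccos_le_pi z])

lemma bParam_mem_of_le (h0 : 0 < x) (hx : x ≤ 3 / 10) :
    bParam x ∈ Ioc 0 (5 / 3) ∧ bParam x ^ 2 / 2 - bParam x ^ 3 / 5 = x := by
  have hy_sq : √(6 * x) ^ 2 = 6 * x := Real.sq_sqrt (by linarith)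
  have hy : 0 < √(6 * x) := Real.sqrt_pos.2 (by linarith)
  have hy_le : √(6 * x) ≤ 5 / 3 := Real.sqrt_le_iff.2 ⟨by norm_num, by linarith⟩
  have h_cubic := cos_one_third_mul_arccos (z := -(3 * √(6 * x) / 5)) (by linarith) (by linarith)
  have hc := half_le_cos_one_third_mul_arccos (-(3 * √(6 * x) / 5))
  rw [bParam, if_pos hx]
  generalize Real.cos (1 / 3 * Real.arccos (-(3 * √(6 * x) / 5))) = c at h_cubic hc ⊢
  generalize √(6 * x) = y at *
  have hc0 : 0 < c := one_half_pos.trans_le hc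
  obtain ⟨b, rfl⟩ : ∃ b, y = b * (2 * c) := ⟨y / (2 * c), by field_simp⟩
  rw [mul_div_cancel_right₀ b (by positivity)]
  have h_quad : 4 * c ^ 2 = 3 - 6 * b / 5 := mul_left_cancel₀ hc0.ne' (by linarith)
  refine ⟨⟨pos_of_mul_pos_left hy (by positivity), by nlinarith⟩, ?_⟩
  calc b ^ 2 / 2 - b ^ 3 / 5 = b ^ 2 * (3 - 6 * b / 5) / 6 := by ring
    _ = (b * (2 * c)) ^ 2 / 6 := by rw [← h_quad]; ring
    _ = x := by rw [hy_sq]; ring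

lemma bParam_le_one (h0 : 0 < x) (hx : x ≤ 3 / 10) : bParam x ≤ 1 := by
  obtain ⟨⟨hb0, hb⟩, h_eq⟩ := bParam_mem_of_le h0 hx
  generalize bParam x = b at *
  by_contra! hb1
  have h_factor : 0 < (b - 1) * (3 / 10 + 3 * b / 10 - b ^ 2 / 5) :=
    mul_pos (sub_pos.2 hb1) (by nlinarith)
  linarith

lemma one_le_bParam (hx : 3 / 10 < x) (h1 : x < 1) : 1 ≤ bParam x := by
  have h_sqrt : 2 ≤ √(5 * (6 * x - 1)) := Real.le_sqrt_of_sq_le (by linarith)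
  rw [bParam, if_neg hx.not_ge, le_div_iff₀ (by linarith)]
  linarith

lemma bParam_eq_of_gt (hx : 3 / 10 < x) (h1 : x < 1) :
    1 - 1 / bParam x + 3 / (10 * bParam x ^ 2) = x := by
  have h_sq : √(5 * (6 * x - 1)) ^ 2 = 5 * (6 * x - 1) := Real.sq_sqrt (by linarith)
  have h_sqrt := Real.sqrt_nonneg (5 * (6 * x - 1))
  rw [bParam, if_neg hx.not_ge]
  generalize √(5 * (6 * x - 1)) = r at h_sq h_sqrt ⊢
  have h_pos : 0 < 1 - x := by linarith
  field_simp
  obtain rfl : x = (r ^ 2 + 5) / 30 := by linarith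
  ring

lemma bParam_pos (hx : x ∈ Ioo (0 : ℝ) 1) : 0 < bParam x := by
  rcases le_or_gt x (3 / 10) with h | h
  · exact (bParam_mem_of_le hx.1 h).1.1
  · exact one_pos.trans_le (one_le_bParam h hx.2)

theorem chatterjeeXi_bParam (hx : x ∈ Ioo (0 : ℝ) 1) :
    chatterjeeXi (bandCopulaPos (bParam x)) = x := by
  rcases le_or_gt x (3 / 10) with h | h
  · rw [chatterjeeXi_bandCopulaPos_of_le_one (bParam_pos hx) (bParam_le_one hx.1 h),
      (bParam_mem_of_le hx.1 h).2]
  · rw [chatterjeeXi_bandCopulaPos_of_one_le (one_le_bParam h hx.2), bParam_eq_of_gt h hx.2]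

theorem spearmanRho_bParam (hx : x ∈ Ioo (0 : ℝ) 1) :
    spearmanRho (bandCopulaPos (bParam x)) = maxRho x := by
  rw [maxRho, if_neg hx.1.ne']
  rcases le_or_gt x (3 / 10) with h | h
  · rw [spearmanRho_bandCopulaPos_of_le_one (bParam_pos hx) (bParam_le_one hx.1 h), if_pos h]
  · rw [spearmanRho_bandCopulaPos_of_one_le (one_le_bParam h hx.2), if_neg h.not_ge, if_pos hx.2]

lemma maxRho_zero : maxRho 0 = 0 := if_pos rfl

lemma maxRho_one : maxRho 1 = 1 := by norm_num [maxRho]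

lemma le_maxRho_of_forall_le_supportLine {y : ℝ} (hx : x ∈ I)
    (h : ∀ b > 0, y ≤ supportLine b x) : y ≤ maxRho x := by
  rcases hx.1.eq_or_lt with rfl | h0
  · exact (nonpos_of_forall_le_supportLine h).trans_eq maxRho_zero.symm
  rcases hx.2.eq_or_lt with rfl | h1
  · exact (le_one_of_forall_le_supportLine h).trans_eq maxRho_one.symm
  · have hx' : x ∈ Ioo 0 1 := ⟨h0, h1⟩
    have h_line := supportLine_chatterjeeXi (bParam x)
    rw [chatterjeeXi_bParam hx', spearmanRho_bParam hx'] at h_line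
    exact (h _ (bParam_pos hx')).trans_eq h_line

end bParam

section extremes

lemma isCopula_mul : IsCopula fun u v => u * v :=
  .of_two_increasing (fun _ _ => zero_mul _) (fun _ _ => mul_zero _) (fun _ _ => one_mul _)
    (fun _ _ => mul_one _) fun u _ u' _ v _ v' _ h h' => by
      linarith [mul_nonneg (sub_nonneg.2 h) (sub_nonneg.2 h')]

lemma isCopula_min : IsCopula fun u v => min u v :=
  .of_two_increasing (fun _ hv => min_eq_left hv.1) (fun _ hu => min_eq_right hu.1)
    (fun _ hv => min_eq_right hv.2) (fun _ hu => min_eq_left hu.2)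
    fun u _ u' _ v _ v' _ h h' => by
      simp only [min_def]
      split_ifs <;> linarith

lemma chatterjeeXi_mul : chatterjeeXi (fun u v => u * v) = 0 := by
  simp only [chatterjeeXi, deriv_mul_const_field, deriv_id'', one_mul,
    intervalIntegral.integral_const, sub_zero, one_smul, integral_pow]
  norm_num

lemma integral_min_right {v : ℝ} (hv : v ∈ I) :
    ∫ u in (0 : ℝ)..1, min u v = v - v ^ 2 / 2 := by
  have h_int : ∀ a b : ℝ, IntervalIntegrable (fun u => min u v) volume a b := fun a b =>
    (continuous_id.min continuous_const).intervalIntegrable a b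
  have h_low : ∫ u in (0 : ℝ)..v, min u v = ∫ u in (0 : ℝ)..v, u :=
    intervalIntegral.integral_congr_Ioo_of_le hv.1 fun u hu => min_eq_left hu.2.le
  have h_high : ∫ u in v..1, min u v = ∫ _ in v..1, v :=
    intervalIntegral.integral_congr_Ioo_of_le hv.2 fun u hu => min_eq_right hu.1.le
  rw [← intervalIntegral.integral_add_adjacent_intervals (h_int 0 v) (h_int v 1), h_low, h_high,
    integral_id, intervalIntegral.integral_const, smul_eq_mul]
  ring

lemma spearmanRho_min : spearmanRho (fun u v => min u v) = 1 := by
  have h_congr : ∫ v in (0 : ℝ)..1, ∫ u in (0 : ℝ)..1, min u v =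
      ∫ v in (0 : ℝ)..1, (v - v ^ 2 / 2) :=
    intervalIntegral.integral_congr fun v hv => by
      rw [uIcc_of_le zero_le_one] at hv
      exact integral_min_right hv
  rw [isCopula_min.spearmanRho_eq, h_congr, intervalIntegral.integral_sub
    (continuous_id'.intervalIntegrable 0 1) (Continuous.intervalIntegrable (by fun_prop) 0 1),
    intervalIntegral.integral_div, integral_id, integral_pow]
  norm_num

namespace IsCopula

variable {C : ℝ → ℝ → ℝ}

lemma chatterjeeXi_mem (hC : IsCopula C) : chatterjeeXi C ∈ I :=
  ⟨hC.chatterjeeXi_nonneg, hC.chatterjeeXi_le_one⟩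

theorem abs_spearmanRho_le_maxRho (hC : IsCopula C) : |spearmanRho C| ≤ maxRho (chatterjeeXi C) :=
  le_maxRho_of_forall_le_supportLine hC.chatterjeeXi_mem
    fun _ hb => hC.abs_spearmanRho_le_supportLine hb

lemma chatterjeeXi_eq_one (hC : IsCopula C) (h : spearmanRho C = 1) : chatterjeeXi C = 1 :=
  hC.chatterjeeXi_le_one.antisymm <| one_le_of_forall_one_le_supportLine
    fun _ hb => h ▸ hC.spearmanRho_le_supportLine hb

end IsCopula

lemma spearmanRho_mul : spearmanRho (fun u v => u * v) = 0 := by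
  have h_le := isCopula_mul.abs_spearmanRho_le_maxRho
  rw [chatterjeeXi_mul, maxRho_zero] at h_le
  exact abs_nonpos_iff.1 h_le

theorem exists_isCopula_spearmanRho_eq_maxRho {x : ℝ} (hx : x ∈ I) :
    ∃ C, IsCopula C ∧ chatterjeeXi C = x ∧ spearmanRho C = maxRho x := by
  rcases hx.1.eq_or_lt with rfl | h0
  · exact ⟨_, isCopula_mul, chatterjeeXi_mul, spearmanRho_mul.trans maxRho_zero.symm⟩
  rcases hx.2.eq_or_lt with rfl | h1
  · exact ⟨_, isCopula_min, isCopula_min.chatterjeeXi_eq_one spearmanRho_min,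
      spearmanRho_min.trans maxRho_one.symm⟩
  · exact ⟨_, isCopula_bandCopulaPos (bParam_pos ⟨h0, h1⟩), chatterjeeXi_bParam ⟨h0, h1⟩,
      spearmanRho_bParam ⟨h0, h1⟩⟩

end extremes

section region

theorem xiRhoRegion_eq : xiRhoRegion = {p : ℝ × ℝ | p.1 ∈ I ∧ |p.2| ≤ maxRho p.1} := by
  ext ⟨x, y⟩
  constructor
  · rintro ⟨C, hC, h⟩
    obtain ⟨rfl, rfl⟩ := Prod.mk.inj h
    exact ⟨hC.chatterjeeXi_mem, hC.abs_spearmanRho_le_maxRho⟩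
  · rintro ⟨hx, hy⟩
    obtain ⟨C, hC, rfl, h_rho⟩ := exists_isCopula_spearmanRho_eq_maxRho hx
    obtain ⟨D, hD, h_xi, rfl⟩ := hC.exists_chatterjeeXi_eq_spearmanRho_eq (hy.trans_eq h_rho.symm)
    exact ⟨D, hD, by rw [h_xi]⟩

lemma maxRho_le_supportLine {b x : ℝ} (hx : x ∈ I) (hb : 0 < b) :
    maxRho x ≤ supportLine b x := by
  obtain ⟨C, hC, rfl, h_rho⟩ := exists_isCopula_spearmanRho_eq_maxRho hx
  exact h_rho ▸ hC.spearmanRho_le_supportLine hb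

theorem concaveOn_maxRho : ConcaveOn ℝ I maxRho := by
  refine ⟨convex_Icc 0 1, fun x hx y hy p q hp hq hpq => ?_⟩
  refine le_maxRho_of_forall_le_supportLine (convex_Icc 0 1 hx hy hp hq hpq) fun b hb => ?_
  simp only [smul_eq_mul]
  rw [supportLine_combo b x y hpq]
  gcongr
  exacts [maxRho_le_supportLine hx hb, maxRho_le_supportLine hy hb]

lemma convex_setOf_abs_le {E : Type*} [AddCommGroup E] [Module ℝ E] {s : Set E} {f : E → ℝ}
    (hf : ConcaveOn ℝ s f) : Convex ℝ {p : E × ℝ | p.1 ∈ s ∧ |p.2| ≤ f p.1} := by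
  let flip : E × ℝ →ₗ[ℝ] E × ℝ := LinearMap.prodMap LinearMap.id (-LinearMap.id)
  have h_eq : {p : E × ℝ | p.1 ∈ s ∧ |p.2| ≤ f p.1} =
      {p : E × ℝ | p.1 ∈ s ∧ p.2 ≤ f p.1} ∩ flip ⁻¹' {p : E × ℝ | p.1 ∈ s ∧ p.2 ≤ f p.1} := by
    ext p
    simp only [abs_le', mem_inter_iff, mem_preimage, mem_ofPred_eq, flip,
      LinearMap.prodMap_apply, LinearMap.id_apply, LinearMap.neg_apply]
    tauto
  rw [h_eq]
  exact hf.convex_hypograph.inter (hf.convex_hypograph.linear_preimage flip)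

theorem convex_xiRhoRegion : Convex ℝ xiRhoRegion :=
  xiRhoRegion_eq ▸ convex_setOf_abs_le concaveOn_maxRho

end region

section frontier

variable {X : Type*} [TopologicalSpace X] {s t : Set X} {f : X → ℝ} {p : X × ℝ}

lemma abs_le_of_mem_closure_setOf_abs_le (hf : ContinuousAt f p.1)
    (hp : p ∈ closure {q : X × ℝ | q.1 ∈ s ∧ |q.2| ≤ f q.1}) : |p.2| ≤ f p.1 := by
  by_contra! h
  have hf' : ContinuousAt (fun q : X × ℝ => f q.1) p := hf.comp continuousAt_fst
  have h_abs : ContinuousAt (fun q : X × ℝ => |q.2|) p := by fun_prop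
  obtain ⟨q, hq, -, hq'⟩ := mem_closure_iff_nhds.1 hp _ (hf'.eventually_lt h_abs h)
  exact hq.not_ge hq'

lemma mem_interior_setOf_abs_le_iff (hs : s ∈ 𝓝 p.1) (hf : ContinuousAt f p.1) :
    p ∈ interior {q : X × ℝ | q.1 ∈ s ∧ |q.2| ≤ f q.1} ↔ |p.2| < f p.1 := by
  rw [mem_interior_iff_mem_nhds]
  constructor
  · intro h
    have h_fiber : Icc (-f p.1) (f p.1) ∈ 𝓝 p.2 := by
      have h_cont : ContinuousAt (fun y => (p.1, y)) p.2 := by fun_prop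
      filter_upwards [h_cont.preimage_mem_nhds h] with y hy using abs_le.1 hy.2
    rw [← mem_interior_iff_mem_nhds, interior_Icc] at h_fiber
    exact abs_lt.2 h_fiber
  · intro h
    have hf' : ContinuousAt (fun q : X × ℝ => f q.1) p := hf.comp continuousAt_fst
    have h_abs : ContinuousAt (fun q : X × ℝ => |q.2|) p := by fun_prop
    filter_upwards [h_abs.eventually_lt hf' h, continuousAt_fst.preimage_mem_nhds hs]
      with q hq hqs using ⟨hqs, hq.le⟩

lemma mem_frontier_setOf_abs_le_iff (hs : s ∈ 𝓝 p.1) (hf : ContinuousAt f p.1) :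
    p ∈ frontier {q : X × ℝ | q.1 ∈ s ∧ |q.2| ≤ f q.1} ↔ |p.2| = f p.1 := by
  rw [frontier, mem_sdiff, mem_interior_setOf_abs_le_iff hs hf, not_lt]
  exact ⟨fun h => (abs_le_of_mem_closure_setOf_abs_le hf h.1).antisymm h.2,
    fun h => ⟨subset_closure ⟨mem_of_mem_nhds hs, h.le⟩, h.ge⟩⟩

lemma continuousAt_maxRho {x : ℝ} (hx : x ∈ Ioo (0 : ℝ) 1) : ContinuousAt maxRho x :=
  ((concaveOn_maxRho.subset Ioo_subset_Icc_self (convex_Ioo 0 1)).continuousOn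
    isOpen_Ioo).continuousAt (isOpen_Ioo.mem_nhds hx)

theorem mem_frontier_xiRhoRegion_iff {p : ℝ × ℝ} (hp : p.1 ∈ Ioo (0 : ℝ) 1) :
    p ∈ frontier xiRhoRegion ↔ |p.2| = maxRho p.1 := by
  rw [xiRhoRegion_eq]
  exact mem_frontier_setOf_abs_le_iff (Icc_mem_nhds hp.1 hp.2) (continuousAt_maxRho hp)

end frontier

section bandCopula

variable {C : ℝ → ℝ → ℝ} {b x : ℝ}

lemma chatterjeeXi_bandCopulaPos_mem (hb : 0 < b) :
    chatterjeeXi (bandCopulaPos b) ∈ Ioo (0 : ℝ) 1 := by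
  rcases le_total b 1 with h | h
  · rw [chatterjeeXi_bandCopulaPos_of_le_one hb h]
    constructor <;> nlinarith [pow_pos hb 2]
  · have h_eq : 1 - 1 / b + 3 / (10 * b ^ 2) = 1 - 1 / b * (1 - 3 / 10 * (1 / b)) := by ring
    have h_inv : 1 / b ∈ Ioc (0 : ℝ) 1 := ⟨by positivity, (div_le_one hb).2 h⟩
    rw [chatterjeeXi_bandCopulaPos_of_one_le h, h_eq]
    constructor <;> nlinarith [h_inv.1, h_inv.2]

lemma abs_spearmanRho_bandCopulaPos (hb : 0 < b) :
    |spearmanRho (bandCopulaPos b)| = maxRho (chatterjeeXi (bandCopulaPos b)) := by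
  have hB := isCopula_bandCopulaPos hb
  have h_le := maxRho_le_supportLine hB.chatterjeeXi_mem hb
  rw [supportLine_chatterjeeXi] at h_le
  exact hB.abs_spearmanRho_le_maxRho.antisymm (h_le.trans (le_abs_self _))

lemma bandCopula_of_pos (hb : 0 < b) : bandCopula b = bandCopulaPos b :=
  funext₂ fun _ _ => if_pos hb

lemma bandCopula_neg (hb : 0 < b) : bandCopula (-b) = reflection (bandCopula b) := by
  funext u v
  rw [reflection, bandCopula_of_pos hb, bandCopula, if_neg (neg_neg_of_pos hb).not_gt, neg_neg]

lemma isCopula_bandCopula_of_pos (hb : 0 < b) : IsCopula (bandCopula b) :=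
  bandCopula_of_pos hb ▸ isCopula_bandCopulaPos hb

lemma isCopula_bandCopula_neg (hb : 0 < b) : IsCopula (bandCopula (-b)) :=
  bandCopula_neg hb ▸ (isCopula_bandCopula_of_pos hb).isCopula_reflection

theorem isCopula_bandCopula (hb : b ≠ 0) : IsCopula (bandCopula b) := by
  rcases hb.lt_or_gt with h | h
  · exact neg_neg b ▸ isCopula_bandCopula_neg (neg_pos.2 h)
  · exact isCopula_bandCopula_of_pos h

lemma chatterjeeXi_bandCopula_neg (hb : 0 < b) :
    chatterjeeXi (bandCopula (-b)) = chatterjeeXi (bandCopula b) := by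
  rw [bandCopula_neg hb, (isCopula_bandCopula_of_pos hb).chatterjeeXi_reflection]

lemma spearmanRho_bandCopula_neg (hb : 0 < b) :
    spearmanRho (bandCopula (-b)) = -spearmanRho (bandCopula b) := by
  rw [bandCopula_neg hb, (isCopula_bandCopula_of_pos hb).spearmanRho_reflection]

theorem chatterjeeXi_bandCopula_bParam (hx : x ∈ Ioo (0 : ℝ) 1) :
    chatterjeeXi (bandCopula (bParam x)) = x := by
  rw [bandCopula_of_pos (bParam_pos hx), chatterjeeXi_bParam hx]

theorem spearmanRho_bandCopula_bParam (hx : x ∈ Ioo (0 : ℝ) 1) :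
    spearmanRho (bandCopula (bParam x)) = maxRho x := by
  rw [bandCopula_of_pos (bParam_pos hx), spearmanRho_bParam hx]

theorem chatterjeeXi_bandCopula_neg_bParam (hx : x ∈ Ioo (0 : ℝ) 1) :
    chatterjeeXi (bandCopula (-bParam x)) = x := by
  rw [chatterjeeXi_bandCopula_neg (bParam_pos hx), chatterjeeXi_bandCopula_bParam hx]

theorem spearmanRho_bandCopula_neg_bParam (hx : x ∈ Ioo (0 : ℝ) 1) :
    spearmanRho (bandCopula (-bParam x)) = -maxRho x := by
  rw [spearmanRho_bandCopula_neg (bParam_pos hx), spearmanRho_bandCopula_bParam hx]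

lemma chatterjeeXi_bandCopula_mem (hb : b ≠ 0) : chatterjeeXi (bandCopula b) ∈ Ioo 0 1 := by
  rcases hb.lt_or_gt with h | h
  · rw [← neg_neg b, chatterjeeXi_bandCopula_neg (neg_pos.2 h), bandCopula_of_pos (neg_pos.2 h)]
    exact chatterjeeXi_bandCopulaPos_mem (neg_pos.2 h)
  · rw [bandCopula_of_pos h]
    exact chatterjeeXi_bandCopulaPos_mem h

lemma abs_spearmanRho_bandCopula (hb : b ≠ 0) :
    |spearmanRho (bandCopula b)| = maxRho (chatterjeeXi (bandCopula b)) := by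
  rcases hb.lt_or_gt with h | h
  · rw [← neg_neg b, spearmanRho_bandCopula_neg (neg_pos.2 h), abs_neg,
      chatterjeeXi_bandCopula_neg (neg_pos.2 h), bandCopula_of_pos (neg_pos.2 h)]
    exact abs_spearmanRho_bandCopulaPos (neg_pos.2 h)
  · rw [bandCopula_of_pos h]
    exact abs_spearmanRho_bandCopulaPos h

theorem frontier_xiRhoRegion_inter :
    frontier xiRhoRegion ∩ {p : ℝ × ℝ | p.1 ∈ Ioo (0 : ℝ) 1} =
      {p : ℝ × ℝ | ∃ b : ℝ, b ≠ 0 ∧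
        p = (chatterjeeXi (bandCopula b), spearmanRho (bandCopula b))} := by
  ext ⟨x, y⟩
  constructor
  · rintro ⟨hp, hx : x ∈ Ioo (0 : ℝ) 1⟩
    have hb := bParam_pos hx
    have h_abs : |y| = maxRho x := (mem_frontier_xiRhoRegion_iff hx).1 hp
    rcases eq_or_eq_neg_of_abs_eq h_abs with rfl | rfl
    · exact ⟨bParam x, hb.ne', by
        rw [chatterjeeXi_bandCopula_bParam hx, spearmanRho_bandCopula_bParam hx]⟩
    · exact ⟨-bParam x, (neg_neg_of_pos hb).ne, by
        rw [chatterjeeXi_bandCopula_neg_bParam hx, spearmanRho_bandCopula_neg_bParam hx]⟩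
  · rintro ⟨b, hb, h⟩
    rw [h]
    have h_xi := chatterjeeXi_bandCopula_mem hb
    exact ⟨(mem_frontier_xiRhoRegion_iff h_xi).2 (abs_spearmanRho_bandCopula hb), h_xi⟩

namespace IsCopula

theorem eq_bandCopula_bParam (hC : IsCopula C) (hx : x ∈ Ioo (0 : ℝ) 1)
    (h_xi : chatterjeeXi C = x) (h_rho : spearmanRho C = maxRho x) {u v : ℝ} (hu : u ∈ I)
    (hv : v ∈ I) : C u v = bandCopula (bParam x) u v := by
  rw [bandCopula_of_pos (bParam_pos hx)]
  exact hC.eq_bandCopulaPos (bParam_pos hx) (h_xi.trans (chatterjeeXi_bParam hx).symm)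
    (h_rho.trans (spearmanRho_bParam hx).symm) hu hv

theorem eq_bandCopula_neg_bParam (hC : IsCopula C) (hx : x ∈ Ioo (0 : ℝ) 1)
    (h_xi : chatterjeeXi C = x) (h_rho : spearmanRho C = -maxRho x) {u v : ℝ} (hu : u ∈ I)
    (hv : v ∈ I) : C u v = bandCopula (-bParam x) u v := by
  have h_refl := hC.isCopula_reflection.eq_bandCopula_bParam hx
    (hC.chatterjeeXi_reflection.trans h_xi) (by rw [hC.spearmanRho_reflection, h_rho, neg_neg])
    (Icc.one_sub_mem hu) hv
  rw [reflection, sub_sub_cancel] at h_refl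
  rw [bandCopula_neg (bParam_pos hx), reflection, ← h_refl, sub_sub_cancel]

end IsCopula

end bandCopula

end

theorem theorem1 :
    -- the exact region
    xiRhoRegion = {p : ℝ × ℝ | p.1 ∈ Set.Icc (0 : ℝ) 1 ∧ |p.2| ≤ maxRho p.1} ∧
    -- it is convex
    Convex ℝ xiRhoRegion ∧
    -- its boundary inside the strip `0 < x < 1` is described by the copula family
    (∀ b : ℝ, b ≠ 0 → IsCopula (bandCopula b)) ∧
    frontier xiRhoRegion ∩ {p : ℝ × ℝ | p.1 ∈ Set.Ioo (0 : ℝ) 1} =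
      {p : ℝ × ℝ | ∃ b : ℝ, b ≠ 0 ∧
        p = (chatterjeeXi (bandCopula b), spearmanRho (bandCopula b))} ∧
    -- the extremal copulas are unique
    (∀ x ∈ Set.Ioo (0 : ℝ) 1,
      (IsCopula (bandCopula (bParam x)) ∧
        chatterjeeXi (bandCopula (bParam x)) = x ∧
        spearmanRho (bandCopula (bParam x)) = maxRho x ∧
        ∀ C : ℝ → ℝ → ℝ, IsCopula C → chatterjeeXi C = x → spearmanRho C = maxRho x →
          ∀ u ∈ Set.Icc (0 : ℝ) 1, ∀ v ∈ Set.Icc (0 : ℝ) 1,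
            C u v = bandCopula (bParam x) u v) ∧
      (IsCopula (bandCopula (-bParam x)) ∧
        chatterjeeXi (bandCopula (-bParam x)) = x ∧
        spearmanRho (bandCopula (-bParam x)) = -maxRho x ∧
        ∀ C : ℝ → ℝ → ℝ, IsCopula C → chatterjeeXi C = x → spearmanRho C = -maxRho x →
          ∀ u ∈ Set.Icc (0 : ℝ) 1, ∀ v ∈ Set.Icc (0 : ℝ) 1,
            C u v = bandCopula (-bParam x) u v)) := by
  refine ⟨xiRhoRegion_eq, convex_xiRhoRegion, fun b hb => isCopula_bandCopula hb,
    frontier_xiRhoRegion_inter, fun x hx => ?_⟩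
  have hb := bParam_pos hx
  exact ⟨⟨isCopula_bandCopula hb.ne', chatterjeeXi_bandCopula_bParam hx,
      spearmanRho_bandCopula_bParam hx,
      fun C hC h_xi h_rho u hu v hv => hC.eq_bandCopula_bParam hx h_xi h_rho hu hv⟩,
    isCopula_bandCopula (neg_neg_of_pos hb).ne, chatterjeeXi_bandCopula_neg_bParam hx,
    spearmanRho_bandCopula_neg_bParam hx,
    fun C hC h_xi h_rho u hu v hv => hC.eq_bandCopula_neg_bParam hx h_xi h_rho hu hv⟩
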